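/- Let $d,w\ge 0$ be integers such that $N:=dw$ is even, and let $R$ be the $d\times w$ rectangle ($d$ rows, $w$ columns). A tableau of shape $R$ is a filling of the boxes of $R$ with positive integers, weakly increasing along rows and down columns. Let $\mathsf{SYT}(R)$ be the set of standard Young tableaux of shape $R$ (entries exactly $1,\dots,N$). A tableau is rotationally-invariant if it is fixed by rotating it by $180^\circ$ inside $R$ and replacing each entry $k$ by $m+1-k$, where $m$ is its largest entry. A domino tableau of shape $R$ is a tableau whose entries are $1,\dots,N/2$ and in which, for each $k$, the boxes with entry $k$ form a $2$-ribbon (a connected skew shape with two boxes, i.e. two adjacent boxes). Sliding a box through a set of entries means: the box repeatedly swaps places with the smaller of those of its east and south neighbours whose entries lie in that set, until neither neighbour's entry does. For $i\ge 1$ let $j_i$ denote promotion restricted to the entries $1,\dots,i$: delete the entry $1$ from the northwest corner, slide the empty box through the entries $2,\dots,i$, decrease these entries by $1$, and put $i$ in the empty box; larger entries are left unchanged. Let $e_k:=j_1\circ j_2\circ\dots\circ j_k$ (evacuation restricted to the entries $1,\dots,k$). For a domino tableau $T$ of shape $R$ and each $k$, colour blue the one of the two entries $k$ that is closer to the northwest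 corner, and the other one red. For $k=N/2,\,N/2-1,\dots,1$ in this order, slide the red $k$ through the blue entries $k+1,\dots,N/2$ and then replace the red $k$ by $k+N/2$. Call the resulting filling $\sigma(T)$, and put $\varphi(T):=e_{N/2}(\sigma(T))$. Then the set of rotationally-invariant tableaux in $\mathsf{SYT}(R)$ and the set of domino tableaux of shape $R$ are finite and have the same number of elements. Moreover, $\sigma(T)\in\mathsf{SYT}(R)$ for every domino tableau $T$ of shape $R$, and $T\mapsto\varphi(T)$ is a bijection from the set of domino tableaux of shape $R$ onto the set of rotationally-invariant tableaux in $\mathsf{SYT}(R)$. -/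

import Mathlib

/-! Boxes are pairs `(row, column) : ℕ × ℕ`, rows numbered downward and columns rightward from `0`
(as in Mathlib's `YoungDiagram`).  A filling of a finite set of boxes is a function `ℕ × ℕ → ℕ`
with value `0` outside that set. -/

namespace RectTableau

/-- The diagram of the rectangular partition with `d` rows and `w` columns. -/
def rect (d w : ℕ) : Finset (ℕ × ℕ) := Finset.range d ×ˢ Finset.range w

/-- A tableau of shape `S`: a filling of `S` with positive integers that is weakly increasing
along rows and down columns. -/
structure IsTableau (S : Finset (ℕ × ℕ)) (T : ℕ × ℕ → ℕ) : Prop where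
  zero_of_notMem : ∀ x, x ∉ S → T x = 0
  pos_of_mem : ∀ x ∈ S, 0 < T x
  row_weak : ∀ i j₁ j₂ : ℕ, j₁ ≤ j₂ → (i, j₁) ∈ S → (i, j₂) ∈ S → T (i, j₁) ≤ T (i, j₂)
  col_weak : ∀ i₁ i₂ j : ℕ, i₁ ≤ i₂ → (i₁, j) ∈ S → (i₂, j) ∈ S → T (i₁, j) ≤ T (i₂, j)

/-- Standard Young tableaux of shape `S`: the entries are exactly `1, …, |S|`
(hence each occurs once). -/
def SYT (S : Finset (ℕ × ℕ)) : Set (ℕ × ℕ → ℕ) :=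
  {T | IsTableau S T ∧ S.image T = Finset.Icc 1 S.card}

/-- A skew shape: the difference of two nested Young diagrams. -/
def IsSkewShape (S : Finset (ℕ × ℕ)) : Prop :=
  ∃ lam mu : YoungDiagram, mu ≤ lam ∧ S = lam.cells \ mu.cells

/-- An `r`-ribbon: a connected skew shape with `r` boxes that contains no `2 × 2` square.
In the Hasse graph of `ℕ × ℕ`, two boxes are adjacent when they share an edge. -/
structure IsRibbon (r : ℕ) (S : Finset (ℕ × ℕ)) : Prop where
  skew : IsSkewShape S
  connected : ((SimpleGraph.hasse (ℕ × ℕ)).induce (S : Set (ℕ × ℕ))).Connected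
  card_eq : S.card = r
  no_square : ∀ i j : ℕ,
    ¬ ((i, j) ∈ S ∧ (i, j + 1) ∈ S ∧ (i + 1, j) ∈ S ∧ (i + 1, j + 1) ∈ S)

/-- Standard `r`-ribbon tableaux of shape `S`: `|S| = r ℓ`, the entries are exactly `1, …, ℓ`, and
the boxes with any given entry form an `r`-ribbon. -/
def SRT (r : ℕ) (S : Finset (ℕ × ℕ)) : Set (ℕ × ℕ → ℕ) :=
  {T | IsTableau S T ∧ ∃ l : ℕ, S.card = r * l ∧ S.image T = Finset.Icc 1 l ∧
    ∀ i ∈ Finset.Icc 1 l, IsRibbon r (S.filter fun x => T x = i)}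

/-- Domino tableaux are standard `2`-ribbon tableaux. -/
def dominoTableaux (S : Finset (ℕ × ℕ)) : Set (ℕ × ℕ → ℕ) := SRT 2 S

/-- Rotate a filling of the `d × w` rectangle by 180° and replace each entry `k` by `m + 1 - k`,
where `m` is the largest entry. -/
def rotate (d w : ℕ) (T : ℕ × ℕ → ℕ) : ℕ × ℕ → ℕ := fun x =>
  if x ∈ rect d w then (rect d w).sup T + 1 - T (d - 1 - x.1, w - 1 - x.2) else 0

/-- The rotationally-invariant standard Young tableaux of shape the `d × w` rectangle. -/
def rotInvSYT (d w : ℕ) : Set (ℕ × ℕ → ℕ) := {T | T ∈ SYT (rect d w) ∧ rotate d w T = T}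

/-- One step of sliding a distinguished box through the entries with values in `[a, c]`.
The state is a filling together with the position of the sliding box.  Among the neighbours to the
east and to the south whose entries lie in `[a, c]`, the sliding box swaps places with the smaller;
if there is none, nothing happens. -/
def slideStep (a c : ℕ) (s : (ℕ × ℕ → ℕ) × (ℕ × ℕ)) : (ℕ × ℕ → ℕ) × (ℕ × ℕ) :=
  if s.1 (s.2.1, s.2.2 + 1) ∈ Finset.Icc a c ∧
      (s.1 (s.2.1 + 1, s.2.2) ∈ Finset.Icc a c →
        s.1 (s.2.1, s.2.2 + 1) < s.1 (s.2.1 + 1, s.2.2)) then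
    (s.1 ∘ Equiv.swap s.2 (s.2.1, s.2.2 + 1), (s.2.1, s.2.2 + 1))
  else if s.1 (s.2.1 + 1, s.2.2) ∈ Finset.Icc a c then
    (s.1 ∘ Equiv.swap s.2 (s.2.1 + 1, s.2.2), (s.2.1 + 1, s.2.2))
  else s

/-- Slide the box at `b` through the entries with values in `[a, c]` until it can no longer move.
(When each of the values `a, …, c` occurs at most once, the box passes each of them at most once,
so that `c + 1 - a` steps suffice.)  The result is the new filling and the final position. -/
def slide (a c : ℕ) (T : ℕ × ℕ → ℕ) (b : ℕ × ℕ) : (ℕ × ℕ → ℕ) × (ℕ × ℕ) :=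
  (slideStep a c)^[c + 1 - a] (T, b)

/-- Decrement a value in `[2, i]` by one, and leave other values alone. -/
def decr (i v : ℕ) : ℕ := if v ∈ Finset.Icc 2 i then v - 1 else v

/-- Jeu de taquin promotion restricted to the entries `1, …, i` (for `1 ≤ i`): delete the entry `1`
from the northwest corner, slide the empty box through the entries `2, …, i`, decrement these
entries, and place `i` in the empty box.  Entries larger than `i` are frozen. -/
def promotion (i : ℕ) (T : ℕ × ℕ → ℕ) : ℕ × ℕ → ℕ :=
  let s := slide 2 i (Function.update T (0, 0) 0) (0, 0)
  Function.update (fun x => decr i (s.1 x)) s.2 i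

/-- Evacuation restricted to the entries `1, …, k`:
`j₁ ∘ j₂ ∘ ⋯ ∘ j_k`, where `j_i` is promotion restricted to the entries `1, …, i`. -/
def evacuation : ℕ → (ℕ × ℕ → ℕ) → (ℕ × ℕ → ℕ)
  | 0, T => T
  | k + 1, T => evacuation k (promotion (k + 1) T)

/-- The position of the red `k` in a domino tableau `T` of shape the `d × w` rectangle: of the two
adjacent boxes with entry `k`, the one further from the northwest corner, which is their
coordinatewise maximum. -/
def redBox (d w : ℕ) (T : ℕ × ℕ → ℕ) (k : ℕ) : ℕ × ℕ :=
  ((rect d w).filter fun x => T x = k).sup id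

/-- With `M = N / 2`: slide the red `k` through the blue entries `k + 1, …, M`, and then replace it
by `k + M`.  At the time when this is applied, the current filling `U` has only blue entries with
values in `[k + 1, M]`, as the larger red ones have been replaced by values exceeding `M`; and the
red `k` is still where it was in the domino tableau `T`. -/
def redStep (d w M : ℕ) (T : ℕ × ℕ → ℕ) (k : ℕ) (U : ℕ × ℕ → ℕ) : ℕ × ℕ → ℕ :=
  let s := slide (k + 1) M U (redBox d w T k)
  Function.update s.1 s.2 (k + M)

/-- Apply `redStep` for `k, k - 1, …, 1` in this (descending) order to the filling `U`. -/
def redSlidesFrom (d w M : ℕ) (T : ℕ × ℕ → ℕ) : ℕ → (ℕ × ℕ → ℕ) → (ℕ × ℕ → ℕ)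
  | 0, U => U
  | k + 1, U => redSlidesFrom d w M T k (redStep d w M T (k + 1) U)

/-- The filling obtained from a domino tableau `T` of shape the `d × w` rectangle by sliding all red
entries, starting with `k = N / 2` and descending to `k = 1`, where `N = d w`. -/
def redSlides (d w : ℕ) (T : ℕ × ℕ → ℕ) : ℕ × ℕ → ℕ :=
  redSlidesFrom d w (d * w / 2) T (d * w / 2) T

/-- The map `φ`: slide the red entries, then apply evacuation restricted to `1, …, N / 2`. -/
def phi (d w : ℕ) (T : ℕ × ℕ → ℕ) : ℕ × ℕ → ℕ := evacuation (d * w / 2) (redSlides d w T)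

end RectTableau

/-! A standard tableau is encoded by the sequence of boxes that contain 1, 2, …, N: a linear
extension of the rectangle. The Bender–Knuth involution `toggle i` exchanges two consecutive boxes
unless they lie on neighbouring diagonals, which for consecutive boxes of a linear extension amounts
to being comparable. Jeu de taquin slides then become products of consecutive toggles
(`Reads.slide`): promotion is `pass 0 i`, evacuation is `evac n`, and sliding all red entries is
`unshuffle M M`, where N = 2M. If a domino tableau is read as a linear extension in which every blue
box is directly followed by its red partner, then φ is the action of the single permutation g =
`evac M * unshuffle M M`.

Two facts carry the theorem. The first is the identity `evac_mul_unshuffle`: `evac (2 * M)` composed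
with g equals g composed with δ = `dominoToggle M`, the product of the toggles of even index below
2M. It uses only that toggles are involutions and that toggles of index at least two apart commute.
Hence g carries the fixed points of δ to the fixed points of evacuation, and a linear extension is
fixed by δ exactly when its boxes pair up into dominoes.

The second is Schützenberger's theorem `IsLinExt.evac_eq_rot`: on a rectangle, full evacuation is
rotation by 180°, so that its fixed points are the rotationally-invariant tableaux. The proof is
Haiman's, by dual equivalence. Evacuation and rotation both turn an elementary dual equivalence at
place i into one at place N - 3 - i, where the partner is unique (`Knuth.evac`, `Knuth.rot`,
`Knuth.unique`). All linear extensions are connected by such moves (`IsLinExt.induction_knuth`), so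
agreement at one of them suffices; the row reading serves, since its descents determine it and both
maps fix it. -/

namespace RectTableau

/-! ### Toggles on sequences of boxes. -/

/-- The content of a box. -/
def content (x : ℕ × ℕ) : ℤ := (x.2 : ℤ) - x.1

/-- Two boxes lie on neighbouring diagonals. -/
def Near (x y : ℕ × ℕ) : Prop := content x = content y + 1 ∨ content y = content x + 1

theorem near_comm {x y : ℕ × ℕ} : Near x y ↔ Near y x := or_comm

open Classical in
/-- Exchange the `i`-th and the `i + 1`-st box, unless they lie on neighbouring diagonals. -/
noncomputable def toggleFun (i : ℕ) (p : ℕ → ℕ × ℕ) : ℕ → ℕ × ℕ :=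
  if Near (p i) (p (i + 1)) then p else p ∘ Equiv.swap i (i + 1)

theorem toggleFun_of_near {i : ℕ} {p : ℕ → ℕ × ℕ} (h : Near (p i) (p (i + 1))) :
    toggleFun i p = p := if_pos h

theorem toggleFun_of_not_near {i : ℕ} {p : ℕ → ℕ × ℕ} (h : ¬ Near (p i) (p (i + 1))) :
    toggleFun i p = p ∘ Equiv.swap i (i + 1) := if_neg h

theorem toggleFun_involutive (i : ℕ) : Function.Involutive (toggleFun i) := by
  intro p
  by_cases h : Near (p i) (p (i + 1))
  · rw [toggleFun_of_near h, toggleFun_of_near h]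
  · rw [toggleFun_of_not_near h, toggleFun_of_not_near]
    · ext1 k; simp
    · simpa [near_comm] using h

/-- The Bender–Knuth involution on sequences of boxes. -/
noncomputable def toggle (i : ℕ) : Equiv.Perm (ℕ → ℕ × ℕ) := (toggleFun_involutive i).toPerm

theorem toggle_of_near {i : ℕ} {p : ℕ → ℕ × ℕ} (h : Near (p i) (p (i + 1))) :
    toggle i p = p := if_pos h

theorem toggle_of_not_near {i : ℕ} {p : ℕ → ℕ × ℕ} (h : ¬ Near (p i) (p (i + 1))) :
    toggle i p = p ∘ Equiv.swap i (i + 1) := if_neg h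

theorem toggle_apply_of_ne {i j : ℕ} (p : ℕ → ℕ × ℕ) (h : j ≠ i) (h' : j ≠ i + 1) :
    toggle i p j = p j := by
  by_cases hn : Near (p i) (p (i + 1))
  · rw [toggle_of_near hn]
  · rw [toggle_of_not_near hn, Function.comp_apply, Equiv.swap_apply_of_ne_of_ne h h']

theorem toggle_mul_self (i : ℕ) : toggle i * toggle i = 1 :=
  Equiv.ext fun p => toggleFun_involutive i p

theorem toggle_inv (i : ℕ) : (toggle i)⁻¹ = toggle i :=
  inv_eq_of_mul_eq_one_left (toggle_mul_self i)

theorem toggle_commute {i j : ℕ} (h : i + 2 ≤ j) : Commute (toggle i) (toggle j) := by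
  refine Equiv.ext fun p => ?_
  simp only [Equiv.Perm.mul_apply]
  have e1 : toggle j p i = p i := toggle_apply_of_ne p (by lia) (by lia)
  have e2 : toggle j p (i + 1) = p (i + 1) := toggle_apply_of_ne p (by lia) (by lia)
  have e3 : toggle i p j = p j := toggle_apply_of_ne p (by lia) (by lia)
  have e4 : toggle i p (j + 1) = p (j + 1) := toggle_apply_of_ne p (by lia) (by lia)
  by_cases hi : Near (p i) (p (i + 1)) <;> by_cases hj : Near (p j) (p (j + 1))
  · rw [toggle_of_near hj, toggle_of_near hi, toggle_of_near hj]
  · rw [toggle_of_near (p := p) hi, toggle_of_near]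
    rwa [e1, e2]
  · rw [toggle_of_near (p := p) hj, eq_comm, toggle_of_near]
    rwa [e3, e4]
  · rw [toggle_of_not_near (p := toggle j p) (by rwa [e1, e2]),
      toggle_of_not_near (p := toggle i p) (by rwa [e3, e4]),
      toggle_of_not_near hj, toggle_of_not_near hi, Function.comp_assoc, Function.comp_assoc]
    congr 1
    have hd : Equiv.Perm.Disjoint (Equiv.swap i (i + 1)) (Equiv.swap j (j + 1)) := by
      intro k
      by_cases hk : k = i ∨ k = i + 1
      · right; exact Equiv.swap_apply_of_ne_of_ne (by lia) (by lia)
      · left; exact Equiv.swap_apply_of_ne_of_ne (by lia) (by lia)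
    exact (congrArg (fun g : Equiv.Perm ℕ => (g : ℕ → ℕ)) hd.commute.eq).symm

/-! ### Identities between products of toggles. -/

/-- Permutations commuting with all toggles of index at least `m`. -/
def Low (m : ℕ) (g : Equiv.Perm (ℕ → ℕ × ℕ)) : Prop := ∀ j, m ≤ j → Commute g (toggle j)

theorem low_one (m : ℕ) : Low m 1 := fun _ _ => Commute.one_left _

theorem Low.mul {m : ℕ} {g h : Equiv.Perm (ℕ → ℕ × ℕ)} (hg : Low m g) (hh : Low m h) :
    Low m (g * h) := fun j hj => (hg j hj).mul_left (hh j hj)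

theorem low_toggle {i m : ℕ} (h : i + 2 ≤ m) : Low m (toggle i) :=
  fun _ hj => toggle_commute (h.trans hj)

/-- Move the `s`-th box past the next `m` ones. -/
noncomputable def pass (s : ℕ) : ℕ → Equiv.Perm (ℕ → ℕ × ℕ)
  | 0 => 1
  | m + 1 => toggle (s + m) * pass s m

theorem pass_succ' (s m : ℕ) : pass s (m + 1) = pass (s + 1) m * toggle s := by
  induction m with
  | zero => simp [pass]
  | succ m ih =>
    rw [pass, ih, pass, ← mul_assoc, Nat.add_right_comm s 1 m, Nat.add_assoc]

theorem low_pass {s m n : ℕ} (h : s + m + 1 ≤ n) : Low n (pass s m) := by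
  induction m with
  | zero => exact low_one n
  | succ m ih => exact (low_toggle (by lia)).mul (ih (by lia))

/-- Evacuation of the first `n` boxes. -/
noncomputable def evac : ℕ → Equiv.Perm (ℕ → ℕ × ℕ)
  | 0 => 1
  | n + 1 => evac n * pass 0 n

theorem low_evac {n m : ℕ} (h : n ≤ m) : Low m (evac n) := by
  induction n with
  | zero => exact low_one m
  | succ n ih => exact (ih (by lia)).mul (low_pass (by lia))

/-- Evacuation conjugates promotion into its inverse. The toggle gained at each stage has an index
too large to meet `evac n`, so it can be moved across. -/
theorem evac_succ' (n : ℕ) : evac (n + 1) = (pass 0 n)⁻¹ * evac n := by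
  induction n with
  | zero => simp [evac, pass]
  | succ n ih =>
    have h1 : evac n * toggle n = toggle n * evac n := low_evac le_rfl n le_rfl
    have h2 : pass 0 (n + 1) = toggle n * pass 0 n := by rw [pass, zero_add]
    have h3 : evac n * pass 0 n = (pass 0 n)⁻¹ * evac n := ih
    calc evac (n + 1 + 1) = (pass 0 n)⁻¹ * (evac n * toggle n) * pass 0 n := by
          rw [evac, ih, h2]; group
      _ = (pass 0 n)⁻¹ * toggle n * (evac n * pass 0 n) := by rw [h1]; group
      _ = _ := by rw [h2, mul_inv_rev, toggle_inv, evac]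

/-- Move the boxes of index `2 k - 1, 2 k - 3, …, 1` to the places `M + k - 1, …, M`. -/
noncomputable def unshuffle (M : ℕ) : ℕ → Equiv.Perm (ℕ → ℕ × ℕ)
  | 0 => 1
  | k + 1 => unshuffle M k * pass (2 * k + 1) (M - 1 - k)

theorem low_unshuffle {M k n : ℕ} (hk : k ≤ M) (h : M + k ≤ n) : Low n (unshuffle M k) := by
  induction k with
  | zero => exact low_one n
  | succ k ih => exact (ih (by lia) (by lia)).mul (low_pass (by lia))

/-- Raising `M` by one lengthens the `j`-th pass by the toggle of index `M + j`. These extra toggles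
commute past the shorter unshuffles to their right in the recursion and collect on the left into an
inverse pass. -/
theorem unshuffle_succ (M k : ℕ) (h : k ≤ M) :
    unshuffle (M + 1) k = (pass M k)⁻¹ * unshuffle M k := by
  induction k with
  | zero => simp [unshuffle, pass]
  | succ k ih =>
    have h1 : unshuffle M k * toggle (M + k) = toggle (M + k) * unshuffle M k :=
      low_unshuffle (by lia) le_rfl _ le_rfl
    have h2 : M + 1 - 1 - k = (M - 1 - k) + 1 := by lia
    have h3 : 2 * k + 1 + (M - 1 - k) = M + k := by lia
    rw [unshuffle, unshuffle, ih (by lia), h2, pass, h3, pass, mul_inv_rev, toggle_inv]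
    simp only [mul_assoc]
    rw [← mul_assoc (unshuffle M k), h1, mul_assoc]

/-- Exchange the boxes of index `2 k`, `2 k + 1` for all `k < M`. -/
noncomputable def dominoToggle : ℕ → Equiv.Perm (ℕ → ℕ × ℕ)
  | 0 => 1
  | M + 1 => dominoToggle M * toggle (2 * M)

theorem pass_add (s m n : ℕ) : pass s (m + n) = pass (s + m) n * pass s m := by
  induction n with
  | zero => simp [pass]
  | succ n ih => rw [← add_assoc, pass, ih, pass, mul_assoc, add_assoc]

/-- The recursion for g: the inverse passes produced by `evac_succ'` and `unshuffle_succ` become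
adjacent, because `evac M` commutes with toggles of index at least `M`, and join into one long pass.
-/
theorem evac_unshuffle_succ (M : ℕ) :
    evac (M + 1) * unshuffle (M + 1) (M + 1) =
      (pass 0 (2 * M))⁻¹ * (evac M * unshuffle M M) := by
  have h : Commute (evac M) (pass M M) := by
    have : ∀ n, Commute (evac M) (pass M n) := by
      intro n
      induction n with
      | zero => exact Commute.one_right _
      | succ n ih => exact (low_evac le_rfl _ (by lia)).mul_right ih
    exact this M
  have h2 : evac M * (pass M M)⁻¹ = (pass M M)⁻¹ * evac M := h.inv_right.eq
  have h3 : pass 0 (2 * M) = pass M M * pass 0 M := by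
    rw [two_mul, pass_add, zero_add]
  have h4 : M + 1 - 1 - M = 0 := by lia
  rw [unshuffle, h4, pass, mul_one, unshuffle_succ M M le_rfl, evac_succ', h3, mul_inv_rev]
  simp only [mul_assoc]
  rw [← mul_assoc (evac M), h2, mul_assoc]

/-- Both recursions of evacuation are applied to peel off two boxes. The long passes cancel against
the one in the recursion for g, leaving just the toggle of index `2 * M`, which commutes with the
smaller g and becomes the new factor of `dominoToggle`. -/
theorem evac_mul_unshuffle (M : ℕ) :
    evac (2 * M) * (evac M * unshuffle M M) = evac M * unshuffle M M * dominoToggle M := by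
  induction M with
  | zero => simp [evac, unshuffle, dominoToggle]
  | succ M ih =>
    have hl : Low (2 * M) (evac M * unshuffle M M) :=
      (low_evac (by lia)).mul (low_unshuffle le_rfl (by lia))
    have hp : pass 0 (2 * M + 1) = toggle (2 * M) * pass 0 (2 * M) := by rw [pass, zero_add]
    have hc := (hl (2 * M) le_rfl).eq
    rw [evac_unshuffle_succ, dominoToggle, show 2 * (M + 1) = 2 * M + 1 + 1 by lia, evac, hp,
      evac_succ']
    generalize evac M * unshuffle M M = g at *
    calc _ = (pass 0 (2 * M))⁻¹ * evac (2 * M) * (toggle (2 * M) * g) := by group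
      _ = (pass 0 (2 * M))⁻¹ * (evac (2 * M) * g) * toggle (2 * M) := by rw [← hc]; group
      _ = _ := by rw [ih]; group

theorem dominoToggle_apply_of_le {M k : ℕ} (h : 2 * M ≤ k) (p : ℕ → ℕ × ℕ) :
    dominoToggle M p k = p k := by
  induction M generalizing p with
  | zero => rfl
  | succ M ih =>
    rw [dominoToggle, Equiv.Perm.mul_apply, ih (by lia), toggle_apply_of_ne _ (by lia) (by lia)]

/-- The factors move disjoint pairs of places, so no factor can undo another. -/
theorem dominoToggle_eq_self_iff {M : ℕ} {p : ℕ → ℕ × ℕ} :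
    dominoToggle M p = p ↔ ∀ k < M, toggle (2 * k) p = p := by
  induction M with
  | zero => simp [dominoToggle]
  | succ M ih =>
    constructor
    · intro h
      have h1 : toggle (2 * M) p = p := by
        ext1 j
        by_cases hj : j = 2 * M ∨ j = 2 * M + 1
        · have := congrFun h j
          rwa [dominoToggle, Equiv.Perm.mul_apply, dominoToggle_apply_of_le (by lia)] at this
        · exact toggle_apply_of_ne _ (by lia) (by lia)
      rw [dominoToggle, Equiv.Perm.mul_apply, h1] at h
      intro k hk
      rcases Nat.lt_succ_iff_lt_or_eq.mp hk with hk | rfl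
      · exact ih.mp h k hk
      · exact h1
    · intro h
      rw [dominoToggle, Equiv.Perm.mul_apply, h M (by lia)]
      exact ih.mpr fun k hk => h k (by lia)

/-! ### Linear extensions of the rectangle. -/

theorem mem_rect {d w : ℕ} {x : ℕ × ℕ} : x ∈ rect d w ↔ x.1 < d ∧ x.2 < w := by
  simp [rect]

theorem card_rect (d w : ℕ) : (rect d w).card = d * w := by simp [rect]

theorem mem_rect_of_le {d w : ℕ} {x y : ℕ × ℕ} (h : x ≤ y) (hy : y ∈ rect d w) :
    x ∈ rect d w := by
  rw [mem_rect] at *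
  exact ⟨h.1.trans_lt hy.1, h.2.trans_lt hy.2⟩

/-- The sequence `p 0, …, p (d w - 1)` is a linear extension of the `d × w` rectangle. -/
structure IsLinExt (d w : ℕ) (p : ℕ → ℕ × ℕ) : Prop where
  mem : ∀ k < d * w, p k ∈ rect d w
  le_of_le : ∀ k < d * w, ∀ l < d * w, p k ≤ p l → k ≤ l
  zero : ∀ k, d * w ≤ k → p k = 0

namespace IsLinExt

variable {d w : ℕ} {p : ℕ → ℕ × ℕ}

theorem inj (hp : IsLinExt d w p) {k l : ℕ} (hk : k < d * w) (hl : l < d * w)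
    (h : p k = p l) : k = l :=
  le_antisymm (hp.le_of_le k hk l hl h.le) (hp.le_of_le l hl k hk h.ge)

theorem surj (hp : IsLinExt d w p) {x : ℕ × ℕ} (hx : x ∈ rect d w) :
    ∃ k < d * w, p k = x := by
  have := Finset.surj_on_of_inj_on_of_card_le (s := Finset.range (d * w)) (t := rect d w)
    (fun k _ => p k) (fun k hk => hp.mem k (Finset.mem_range.mp hk))
    (fun k l hk hl h => hp.inj (Finset.mem_range.mp hk) (Finset.mem_range.mp hl) h)
    (by rw [card_rect, Finset.card_range]) x hx
  obtain ⟨k, hk, h⟩ := this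
  exact ⟨k, Finset.mem_range.mp hk, h.symm⟩

theorem exists_of_le (hp : IsLinExt d w p) {x : ℕ × ℕ} {l : ℕ} (hl : l < d * w) (h : x ≤ p l) :
    ∃ k ≤ l, p k = x := by
  obtain ⟨k, hk, rfl⟩ := hp.surj (mem_rect_of_le h (hp.mem l hl))
  exact ⟨k, hp.le_of_le k hk l hl h, rfl⟩

theorem swap (hp : IsLinExt d w p) {i : ℕ} (hi : i + 1 < d * w) (h : ¬ p i ≤ p (i + 1)) :
    IsLinExt d w (p ∘ Equiv.swap i (i + 1)) := by
  have key : ∀ k, k < d * w → Equiv.swap i (i + 1) k < d * w := by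
    intro k hk
    rw [Equiv.swap_apply_def]
    split_ifs <;> lia
  refine ⟨fun k hk => hp.mem _ (key k hk), fun k hk l hl hkl => ?_, fun k hk => ?_⟩
  · have h1 := hp.le_of_le _ (key k hk) _ (key l hl) hkl
    simp only [Function.comp_apply] at hkl
    rw [Equiv.swap_apply_def, Equiv.swap_apply_def] at h1 hkl
    split_ifs at h1 hkl <;> subst_vars <;> lia
  · rw [Function.comp_apply, Equiv.swap_apply_of_ne_of_ne (by lia) (by lia), hp.zero k hk]

/-- Two boxes on neighbouring diagonals are always comparable; the sequence decides which one is
smaller. -/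
theorem le_of_near (hp : IsLinExt d w p) {i j : ℕ} (hij : i < j) (hj : j < d * w)
    (h : Near (p i) (p j)) : p i ≤ p j := by
  by_contra hn
  have h2 : ¬ p j ≤ p i := fun h' => by have := hp.le_of_le j hj i (by lia) h'; lia
  rw [Prod.le_def] at hn h2
  unfold Near content at h
  lia

/-- A box that follows a smaller one immediately is its east or south neighbour. -/
theorem eq_of_le_succ (hp : IsLinExt d w p) {i : ℕ} (hi : i + 1 < d * w)
    (h : p i ≤ p (i + 1)) :
    p (i + 1) = ((p i).1, (p i).2 + 1) ∨ p (i + 1) = ((p i).1 + 1, (p i).2) := by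
  have hne : p i ≠ p (i + 1) := fun h' => by have := hp.inj (by lia) hi h'; lia
  have key : ∀ y, p i ≤ y → y ≤ p (i + 1) → y ≠ p i → p (i + 1) = y := by
    intro y h1 h2 h3
    obtain ⟨k, hk, rfl⟩ := hp.exists_of_le hi h2
    have := hp.le_of_le i (by lia) k (by lia) h1
    have : k ≠ i := by rintro rfl; exact h3 rfl
    rw [show k = i + 1 by lia]
  rcases h.1.lt_or_eq with h1 | h1
  · right
    exact key _ ⟨by simp, le_rfl⟩ ⟨h1, h.2⟩ (fun h' => by simpa using congrArg Prod.fst h')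
  · left
    have h2 : (p i).2 < (p (i + 1)).2 :=
      h.2.lt_of_ne fun h' => hne (Prod.ext h1 h')
    exact key _ ⟨le_rfl, by simp⟩ ⟨h.1, h2⟩ (fun h' => by simpa using congrArg Prod.snd h')

/-- This justifies defining toggles by contents: the definition makes sense for all sequences, yet
on linear extensions it exchanges exactly the incomparable pairs. -/
theorem near_succ_iff (hp : IsLinExt d w p) {i : ℕ} (hi : i + 1 < d * w) :
    Near (p i) (p (i + 1)) ↔ p i ≤ p (i + 1) := by
  refine ⟨hp.le_of_near (by lia) hi, fun h => ?_⟩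
  rcases hp.eq_of_le_succ hi h with h | h <;> rw [h] <;> unfold Near content <;> push_cast <;> lia

theorem toggle (hp : IsLinExt d w p) {i : ℕ} (hi : i + 1 < d * w) :
    IsLinExt d w (toggle i p) := by
  by_cases h : Near (p i) (p (i + 1))
  · rwa [toggle_of_near h]
  · rw [toggle_of_not_near h]
    exact hp.swap hi (by rwa [← hp.near_succ_iff hi])

theorem pass (hp : IsLinExt d w p) {s m : ℕ} (h : s + m < d * w) :
    IsLinExt d w (pass s m p) := by
  induction m with
  | zero => exact hp
  | succ m ih => exact (ih (by lia)).toggle (by lia)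

theorem evac (hp : IsLinExt d w p) {n : ℕ} (h : n ≤ d * w) : IsLinExt d w (evac n p) := by
  induction n generalizing p with
  | zero => exact hp
  | succ n ih => exact ih (hp.pass (by lia)) (by lia)

theorem unshuffle (hp : IsLinExt d w p) {M k : ℕ} (h : 2 * M ≤ d * w) (hk : k ≤ M) :
    IsLinExt d w (unshuffle M k p) := by
  induction k generalizing p with
  | zero => exact hp
  | succ k ih => exact ih (hp.pass (by lia)) (by lia)

/-- Between two boxes of the same content there are boxes of the two neighbouring contents. -/
theorem exists_between (hp : IsLinExt d w p) {i j : ℕ} (hij : i < j) (hj : j < d * w)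
    (h : content (p i) = content (p j)) :
    (∃ k, i < k ∧ k < j ∧ content (p k) = content (p i) + 1) ∧
      ∃ k, i < k ∧ k < j ∧ content (p k) = content (p i) - 1 := by
  have h1 : ¬ p j ≤ p i := fun h' => by have := hp.le_of_le j hj i (by lia) h'; lia
  have key : ∀ y, p i ≤ y → y ≤ p j → y ≠ p i → y ≠ p j → ∃ k, i < k ∧ k < j ∧ p k = y := by
    intro y h1 h2 h3 h4
    obtain ⟨k, hk, rfl⟩ := hp.exists_of_le hj h2
    have := hp.le_of_le i (by lia) k (by lia) h1
    have : k ≠ i := by rintro rfl; exact h3 rfl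
    have : k ≠ j := by rintro rfl; exact h4 rfl
    exact ⟨k, by lia, by lia, rfl⟩
  rw [Prod.le_def] at h1
  unfold content at h ⊢
  constructor
  · obtain ⟨k, h1, h2, h3⟩ := key ((p i).1, (p i).2 + 1) ⟨by simp, by simp⟩
      ⟨by simp; lia, by simp; lia⟩
      (fun h' => by simpa using congrArg Prod.snd h')
      (fun h' => by have := congrArg Prod.fst h'; have := congrArg Prod.snd h'; simp at *; lia)
    exact ⟨k, h1, h2, by rw [h3]; push_cast; ring⟩
  · obtain ⟨k, h1, h2, h3⟩ := key ((p i).1 + 1, (p i).2) ⟨by simp, by simp⟩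
      ⟨by simp; lia, by simp; lia⟩
      (fun h' => by simpa using congrArg Prod.fst h')
      (fun h' => by have := congrArg Prod.fst h'; have := congrArg Prod.snd h'; simp at *; lia)
    exact ⟨k, h1, h2, by rw [h3]; push_cast; ring⟩

theorem content_ne_succ (hp : IsLinExt d w p) {i : ℕ} (hi : i + 1 < d * w) :
    content (p i) ≠ content (p (i + 1)) := by
  intro h
  obtain ⟨⟨k, h1, h2, -⟩, -⟩ := hp.exists_between (Nat.lt_succ_self i) hi h
  lia

theorem content_ne_add_two (hp : IsLinExt d w p) {i : ℕ} (hi : i + 2 < d * w) :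
    content (p i) ≠ content (p (i + 2)) := by
  intro h
  obtain ⟨⟨k, h1, h2, h3⟩, ⟨l, h4, h5, h6⟩⟩ :=
    hp.exists_between (show i < i + 2 by lia) hi h
  obtain rfl : k = i + 1 := by lia
  obtain rfl : l = i + 1 := by lia
  lia

/-- Only two places lie in between, so the two neighbouring diagonals must occupy one each: the four
boxes form a square. -/
theorem content_add_three (hp : IsLinExt d w p) {i : ℕ} (hi : i + 3 < d * w)
    (h : content (p i) = content (p (i + 3))) :
    (content (p (i + 1)) = content (p i) + 1 ∧ content (p (i + 2)) = content (p i) - 1) ∨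
    (content (p (i + 1)) = content (p i) - 1 ∧ content (p (i + 2)) = content (p i) + 1) := by
  obtain ⟨⟨k, h1, h2, h3⟩, ⟨l, h4, h5, h6⟩⟩ :=
    hp.exists_between (show i < i + 3 by lia) hi h
  have hk : k = i + 1 ∨ k = i + 2 := by lia
  have hl : l = i + 1 ∨ l = i + 2 := by lia
  rcases hk with rfl | rfl <;> rcases hl with rfl | rfl <;> lia

theorem apply_zero (hp : IsLinExt d w p) : p 0 = 0 := by
  rcases Nat.eq_zero_or_pos (d * w) with h | h
  · exact hp.zero 0 h.le
  · obtain ⟨k, hk, hk'⟩ := hp.exists_of_le h (show (0 : ℕ × ℕ) ≤ p 0 from bot_le)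
    obtain rfl : k = 0 := by lia
    exact hk'

end IsLinExt

/-! ### The effect of a pass on triples of boxes. -/

theorem toggle_apply_left {i : ℕ} {p : ℕ → ℕ × ℕ} [Decidable (Near (p i) (p (i + 1)))] :
    toggle i p i = if Near (p i) (p (i + 1)) then p i else p (i + 1) := by
  split_ifs with h
  · rw [toggle_of_near h]
  · rw [toggle_of_not_near h]; simp

theorem toggle_apply_right {i : ℕ} {p : ℕ → ℕ × ℕ} [Decidable (Near (p i) (p (i + 1)))] :
    toggle i p (i + 1) = if Near (p i) (p (i + 1)) then p (i + 1) else p i := by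
  split_ifs with h
  · rw [toggle_of_near h]
  · rw [toggle_of_not_near h]; simp

open Classical in
/-- The box left behind when the box `x` passes the box `y`. -/
noncomputable def passed (x y : ℕ × ℕ) : ℕ × ℕ := if Near x y then x else y

open Classical in
/-- The moving box after `x` has passed the box `y`. -/
noncomputable def carried (x y : ℕ × ℕ) : ℕ × ℕ := if Near x y then y else x

theorem pass_two_apply (i : ℕ) (p : ℕ → ℕ × ℕ) :
    pass i 2 p i = passed (p i) (p (i + 1)) ∧
    pass i 2 p (i + 1) = passed (carried (p i) (p (i + 1))) (p (i + 2)) ∧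
    pass i 2 p (i + 2) = carried (carried (p i) (p (i + 1))) (p (i + 2)) := by
  classical
  have e (q : ℕ → ℕ × ℕ) : pass i 2 q = toggle (i + 1) (toggle i q) := rfl
  have e2 : toggle i p (i + 2) = p (i + 2) := toggle_apply_of_ne _ (by lia) (by lia)
  have e1 : toggle i p (i + 1) = carried (p i) (p (i + 1)) := by
    rw [toggle_apply_right, carried]
  refine ⟨?_, ?_, ?_⟩
  · rw [e, toggle_apply_of_ne _ (by lia) (by lia), toggle_apply_left, passed]
  · rw [e, toggle_apply_left, e1, add_assoc, e2, passed]
  · rw [e, show i + 2 = i + 1 + 1 from rfl, toggle_apply_right, e1, add_assoc, one_add_one_eq_two, e2]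
    exact rfl

theorem pass_three_apply (i : ℕ) (p : ℕ → ℕ × ℕ) :
    pass i 3 p i = passed (p i) (p (i + 1)) ∧
    pass i 3 p (i + 1) = passed (carried (p i) (p (i + 1))) (p (i + 2)) ∧
    pass i 3 p (i + 2) =
      passed (carried (carried (p i) (p (i + 1))) (p (i + 2))) (p (i + 3)) ∧
    pass i 3 p (i + 3) =
      carried (carried (carried (p i) (p (i + 1))) (p (i + 2))) (p (i + 3)) := by
  classical
  obtain ⟨h1, h2, h3⟩ := pass_two_apply i p
  have e : pass i 3 p = toggle (i + 2) (pass i 2 p) := rfl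
  have e3 : pass i 2 p (i + 3) = p (i + 3) := by
    change toggle (i + 1) (toggle i p) (i + 3) = _
    rw [toggle_apply_of_ne _ (by lia) (by lia), toggle_apply_of_ne _ (by lia) (by lia)]
  refine ⟨?_, ?_, ?_, ?_⟩
  · rw [e, toggle_apply_of_ne _ (by lia) (by lia), h1]
  · rw [e, toggle_apply_of_ne _ (by lia) (by lia), h2]
  · rw [e, toggle_apply_left, h3, add_assoc, e3, passed]
  · rw [e, show i + 3 = i + 2 + 1 from rfl, toggle_apply_right, h3, add_assoc, two_add_one_eq_three,
      e3]
    exact rfl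

/-- `y` lies strictly between `x` and `z` in the order of contents. -/
def Between (x y z : ℕ × ℕ) : Prop :=
  (content x < content y ∧ content y < content z) ∨
    (content z < content y ∧ content y < content x)

/-- An elementary dual equivalence between two triples of boxes. -/
def KnuthTriple (x y z x' y' z' : ℕ × ℕ) : Prop :=
  (x' = x ∧ y' = z ∧ z' = y ∧ Between y x z) ∨ (x' = y ∧ y' = x ∧ z' = z ∧ Between x z y)

/-- The conditions on contents satisfied by four consecutive boxes of a linear extension. -/
def Admissible (x y z t : ℕ × ℕ) : Prop :=
  content x ≠ content y ∧ content y ≠ content z ∧ content z ≠ content t ∧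
  content x ≠ content z ∧ content y ≠ content t ∧
  (content x = content t →
    (content y = content x + 1 ∧ content z = content x - 1) ∨
    (content y = content x - 1 ∧ content z = content x + 1))

theorem IsLinExt.admissible {d w : ℕ} {p : ℕ → ℕ × ℕ} (hp : IsLinExt d w p) {i : ℕ}
    (hi : i + 3 < d * w) : Admissible (p i) (p (i + 1)) (p (i + 2)) (p (i + 3)) :=
  ⟨hp.content_ne_succ (by lia), hp.content_ne_succ (by lia), hp.content_ne_succ (by lia),
    hp.content_ne_add_two (by lia), hp.content_ne_add_two (by lia), hp.content_add_three hi⟩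

/-- The local core of the dual equivalence argument, for exchanging the last two boxes. It is a
finite check over which pairs are near; the impossible patterns are excluded by arithmetic on
contents, for which admissibility of both orders is needed. -/
theorem KnuthTriple.passed_of_between {x y z t : ℕ × ℕ} (h : Between z y t)
    (h1 : Admissible x y z t) (h2 : Admissible x y t z) :
    KnuthTriple (passed x y) (passed (carried x y) z) (passed (carried (carried x y) z) t)
      (passed x y) (passed (carried x y) t) (passed (carried (carried x y) t) z) ∧
    carried (carried (carried x y) z) t = carried (carried (carried x y) t) z := by
  unfold Admissible at h1 h2
  unfold Between at h
  have etz : Near t z ↔ Near z t := near_comm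
  unfold passed carried
  by_cases hxy : Near x y <;> by_cases hxz : Near x z <;> by_cases hxt : Near x t <;>
  by_cases hyz : Near y z <;> by_cases hyt : Near y t <;> by_cases hzt : Near z t <;>
  first
  | (exfalso; unfold Near at *; lia)
  | (simp only [if_true, if_false, etz, hxy, hxz, hxt, hyz, hyt, hzt]
     unfold Near at *
     exact ⟨Or.inl ⟨rfl, rfl, rfl, by unfold Between; lia⟩, trivial⟩)

/-- The companion for exchanging the first two boxes. Here the resulting move may be of either kind.
-/
theorem KnuthTriple.passed_of_between' {x y z t : ℕ × ℕ} (h : Between y t z)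
    (h1 : Admissible x y z t) (h2 : Admissible x z y t) :
    KnuthTriple (passed x y) (passed (carried x y) z) (passed (carried (carried x y) z) t)
      (passed x z) (passed (carried x z) y) (passed (carried (carried x z) y) t) ∧
    carried (carried (carried x y) z) t = carried (carried (carried x z) y) t := by
  unfold Admissible at h1 h2
  unfold Between at h
  have ezy : Near z y ↔ Near y z := near_comm
  unfold passed carried
  by_cases hxy : Near x y <;> by_cases hxz : Near x z <;> by_cases hxt : Near x t <;>
  by_cases hyz : Near y z <;> by_cases hyt : Near y t <;> by_cases hzt : Near z t <;>
  first
  | (exfalso; unfold Near at *; lia)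
  | (simp only [if_true, if_false, ezy, hxy, hxz, hxt, hyz, hyt, hzt]
     unfold Near at *
     first
     | exact ⟨Or.inl ⟨rfl, rfl, rfl, by unfold Between; lia⟩, trivial⟩
     | exact ⟨Or.inr ⟨rfl, rfl, rfl, by unfold Between; lia⟩, trivial⟩)

theorem passed_lt_iff {x y z : ℕ × ℕ} (h1 : content x ≠ content y) (h2 : content x ≠ content z)
    (h3 : content y ≠ content z) :
    content (passed (carried x y) z) < content (passed x y) ↔ content z < content y := by
  unfold passed carried
  by_cases hxy : Near x y <;> by_cases hxz : Near x z <;> by_cases hyz : Near y z <;>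
  simp only [if_true, if_false, hxy, hxz, hyz] <;> unfold Near at * <;> lia

/-! ### Rotation of linear extensions. -/

/-- The sequence of boxes reversed and rotated by 180° in the `d × w` rectangle. -/
def rot (d w : ℕ) (p : ℕ → ℕ × ℕ) : ℕ → ℕ × ℕ := fun k =>
  if k < d * w then (d - 1 - (p (d * w - 1 - k)).1, w - 1 - (p (d * w - 1 - k)).2) else 0

theorem rot_apply {d w k : ℕ} (hk : k < d * w) (p : ℕ → ℕ × ℕ) :
    rot d w p k = (d - 1 - (p (d * w - 1 - k)).1, w - 1 - (p (d * w - 1 - k)).2) := if_pos hk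

theorem rot_apply_of_le {d w k : ℕ} (hk : d * w ≤ k) (p : ℕ → ℕ × ℕ) : rot d w p k = 0 :=
  if_neg (by lia)

theorem IsLinExt.rot {d w : ℕ} {p : ℕ → ℕ × ℕ} (hp : IsLinExt d w p) :
    IsLinExt d w (rot d w p) := by
  refine ⟨fun k hk => ?_, fun k hk l hl h => ?_, fun k hk => rot_apply_of_le hk p⟩
  · have := mem_rect.mp (hp.mem (d * w - 1 - k) (by lia))
    rw [rot_apply hk, mem_rect]
    simp only
    lia
  · have hk' := mem_rect.mp (hp.mem (d * w - 1 - k) (by lia))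
    have hl' := mem_rect.mp (hp.mem (d * w - 1 - l) (by lia))
    rw [rot_apply hk, rot_apply hl, Prod.le_def] at h
    have := hp.le_of_le (d * w - 1 - l) (by lia) (d * w - 1 - k) (by lia)
      (Prod.le_def.mpr (by simp only at h; lia))
    lia

theorem IsLinExt.rot_rot {d w : ℕ} {p : ℕ → ℕ × ℕ} (hp : IsLinExt d w p) :
    RectTableau.rot d w (RectTableau.rot d w p) = p := by
  ext1 k
  by_cases hk : k < d * w
  · have h := mem_rect.mp (hp.mem k hk)
    rw [rot_apply hk, rot_apply (by lia), show d * w - 1 - (d * w - 1 - k) = k by lia]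
    ext <;> simp only <;> lia
  · rw [rot_apply_of_le (by lia), hp.zero k (by lia)]

theorem IsLinExt.content_rot {d w : ℕ} {p : ℕ → ℕ × ℕ} (hp : IsLinExt d w p) {k : ℕ}
    (hk : k < d * w) :
    content (RectTableau.rot d w p k) = w - d - content (p (d * w - 1 - k)) := by
  have h := mem_rect.mp (hp.mem (d * w - 1 - k) (by lia))
  rw [rot_apply hk]
  unfold content
  simp only
  lia

/-- Rotation negates contents up to a constant, so it preserves nearness, while the reversal of the
sequence reflects the index. -/
theorem IsLinExt.rot_toggle {d w : ℕ} {p : ℕ → ℕ × ℕ} (hp : IsLinExt d w p) {i j : ℕ}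
    (hij : i + j + 2 = d * w) :
    RectTableau.rot d w (RectTableau.toggle i p) =
      RectTableau.toggle j (RectTableau.rot d w p) := by
  have e1 : d * w - 1 - j = i + 1 := by lia
  have e2 : d * w - 1 - (j + 1) = i := by lia
  have hn : Near (RectTableau.rot d w p j) (RectTableau.rot d w p (j + 1)) ↔
      Near (p i) (p (i + 1)) := by
    unfold Near
    rw [hp.content_rot (by lia), hp.content_rot (by lia), e1, e2]
    lia
  by_cases h : Near (p i) (p (i + 1))
  · rw [toggle_of_near h, toggle_of_near (hn.mpr h)]
  · rw [toggle_of_not_near h, toggle_of_not_near (mt hn.mp h)]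
    ext1 k
    by_cases hk : k < d * w
    · have h1 : Equiv.swap j (j + 1) k < d * w := by
        rw [Equiv.swap_apply_def]; split_ifs <;> lia
      have h2 : Equiv.swap i (i + 1) (d * w - 1 - k) = d * w - 1 - Equiv.swap j (j + 1) k := by
        rw [Equiv.swap_apply_def, Equiv.swap_apply_def]; split_ifs <;> lia
      rw [Function.comp_apply, rot_apply hk, rot_apply h1, Function.comp_apply, h2]
    · rw [Function.comp_apply, Equiv.swap_apply_of_ne_of_ne (by lia) (by lia),
        rot_apply_of_le (by lia), rot_apply_of_le (by lia)]

theorem IsLinExt.pass_inv {d w : ℕ} {p : ℕ → ℕ × ℕ} (hp : IsLinExt d w p) {s m : ℕ}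
    (h : s + m < d * w) : IsLinExt d w ((RectTableau.pass s m)⁻¹ p) := by
  induction m generalizing p with
  | zero => exact hp
  | succ m ih =>
    rw [RectTableau.pass, mul_inv_rev, toggle_inv]
    exact ih (hp.toggle (by lia)) (by lia)

/-! ### Dual equivalence under passes, rotation and evacuation. -/

/-- `p` and `q` are related by an elementary dual equivalence at the places `i`, `i + 1`,
`i + 2`. -/
structure Knuth (i : ℕ) (p q : ℕ → ℕ × ℕ) : Prop where
  apply_eq : ∀ j, j ≠ i → j ≠ i + 1 → j ≠ i + 2 → q j = p j
  triple : KnuthTriple (p i) (p (i + 1)) (p (i + 2)) (q i) (q (i + 1)) (q (i + 2))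

theorem Knuth.symm {i : ℕ} {p q : ℕ → ℕ × ℕ} (h : Knuth i p q) : Knuth i q p := by
  refine ⟨fun k h1 h2 h3 => (h.apply_eq k h1 h2 h3).symm, ?_⟩
  have := h.triple
  unfold KnuthTriple Between at *
  rcases this with ⟨e1, e2, e3, hb⟩ | ⟨e1, e2, e3, hb⟩ <;> rw [e1, e2, e3]
  · exact Or.inl ⟨rfl, rfl, rfl, by lia⟩
  · exact Or.inr ⟨rfl, rfl, rfl, by lia⟩

/-- The two kinds of move exclude each other, since the first and the third box cannot each have
content between those of the other two. -/
theorem Knuth.unique {i : ℕ} {p q r : ℕ → ℕ × ℕ} (hq : Knuth i p q) (hr : Knuth i p r) :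
    q = r := by
  have h1 := hq.triple
  have h2 := hr.triple
  unfold KnuthTriple Between at h1 h2
  ext1 j
  by_cases hj : j ≠ i ∧ j ≠ i + 1 ∧ j ≠ i + 2
  · rw [hq.apply_eq j hj.1 hj.2.1 hj.2.2, hr.apply_eq j hj.1 hj.2.1 hj.2.2]
  · have : j = i ∨ j = i + 1 ∨ j = i + 2 := by lia
    rcases h1 with ⟨a1, a2, a3, a4⟩ | ⟨a1, a2, a3, a4⟩ <;>
    rcases h2 with ⟨b1, b2, b3, b4⟩ | ⟨b1, b2, b3, b4⟩ <;>
    rcases this with rfl | rfl | rfl <;> first | (exfalso; lia) | simp [*]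

theorem Knuth.toggle {i j : ℕ} {p q : ℕ → ℕ × ℕ} (h : Knuth i p q) (hj : j + 1 < i ∨ i + 3 ≤ j) :
    Knuth i (toggle j p) (toggle j q) := by
  classical
  have e1 : q j = p j := h.apply_eq _ (by lia) (by lia) (by lia)
  have e2 : q (j + 1) = p (j + 1) := h.apply_eq _ (by lia) (by lia) (by lia)
  refine ⟨fun k h1 h2 h3 => ?_, ?_⟩
  · by_cases hk : k = j
    · subst hk
      rw [toggle_apply_left, toggle_apply_left, e1, e2]
    by_cases hk' : k = j + 1
    · subst hk'
      rw [toggle_apply_right, toggle_apply_right, e1, e2]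
    rw [toggle_apply_of_ne _ hk hk', toggle_apply_of_ne _ hk hk', h.apply_eq k h1 h2 h3]
  · rw [toggle_apply_of_ne p, toggle_apply_of_ne p, toggle_apply_of_ne p, toggle_apply_of_ne q,
      toggle_apply_of_ne q, toggle_apply_of_ne q]
    · exact h.triple
    all_goals lia

theorem Knuth.pass {i s m : ℕ} {p q : ℕ → ℕ × ℕ} (h : Knuth i p q)
    (hj : s + m < i ∨ i + 3 ≤ s) : Knuth i (pass s m p) (pass s m q) := by
  induction m with
  | zero => exact h
  | succ m ih => exact (ih (by lia)).toggle (by lia)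

theorem Knuth.pass_inv {i s m : ℕ} {p q : ℕ → ℕ × ℕ} (h : Knuth i p q)
    (hj : s + m < i ∨ i + 3 ≤ s) :
    Knuth i ((RectTableau.pass s m)⁻¹ p) ((RectTableau.pass s m)⁻¹ q) := by
  induction m generalizing p q with
  | zero => exact h
  | succ m ih =>
    rw [RectTableau.pass, mul_inv_rev, toggle_inv]
    exact ih (h.toggle (by lia)) (by lia)

theorem pass_apply_of_lt_or_lt {s m k : ℕ} (h : k < s ∨ s + m < k) (p : ℕ → ℕ × ℕ) :
    pass s m p k = p k := by
  induction m with
  | zero => rfl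
  | succ m ih =>
    rw [pass, Equiv.Perm.mul_apply, toggle_apply_of_ne _ (by lia) (by lia), ih (by lia)]

theorem Knuth.pass_three {d w i : ℕ} {p q : ℕ → ℕ × ℕ} (hp : IsLinExt d w p)
    (hq : IsLinExt d w q) (hi : i + 3 < d * w) (h : Knuth (i + 1) p q) :
    Knuth i (RectTableau.pass i 3 p) (RectTableau.pass i 3 q) := by
  obtain ⟨p1, p2, p3, p4⟩ := pass_three_apply i p
  obtain ⟨q1, q2, q3, q4⟩ := pass_three_apply i q
  have ap := hp.admissible hi
  have aq := hq.admissible hi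
  have e : q i = p i := h.apply_eq i (by lia) (by lia) (by lia)
  have ht := h.triple
  rw [e] at q1 q2 q3 q4 aq
  simp only [add_assoc, Nat.reduceAdd] at ht
  have key : KnuthTriple (RectTableau.pass i 3 p i) (RectTableau.pass i 3 p (i + 1))
      (RectTableau.pass i 3 p (i + 2)) (RectTableau.pass i 3 q i)
      (RectTableau.pass i 3 q (i + 1)) (RectTableau.pass i 3 q (i + 2)) ∧
      RectTableau.pass i 3 q (i + 3) = RectTableau.pass i 3 p (i + 3) := by
    rw [p1, p2, p3, p4, q1, q2, q3, q4]
    rcases ht with ⟨e1, e2, e3, hb⟩ | ⟨e1, e2, e3, hb⟩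
    · rw [e1, e2, e3] at aq ⊢
      have := KnuthTriple.passed_of_between hb ap aq
      exact ⟨this.1, this.2.symm⟩
    · rw [e1, e2, e3] at aq ⊢
      have := KnuthTriple.passed_of_between' hb ap aq
      exact ⟨this.1, this.2.symm⟩
  refine ⟨fun k h1 h2 h3 => ?_, key.1⟩
  by_cases hk : k = i + 3
  · rw [hk, key.2]
  · rw [pass_apply_of_lt_or_lt (by lia), pass_apply_of_lt_or_lt (by lia),
      h.apply_eq k (by lia) (by lia) (by lia)]

theorem Knuth.rot {d w i j : ℕ} {p q : ℕ → ℕ × ℕ} (hp : IsLinExt d w p) (h : Knuth i p q)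
    (hij : i + j + 3 = d * w) : Knuth j (rot d w p) (rot d w q) := by
  refine ⟨fun k h1 h2 h3 => ?_, ?_⟩
  · by_cases hk : k < d * w
    · rw [rot_apply hk, rot_apply hk, h.apply_eq _ (by lia) (by lia) (by lia)]
    · rw [rot_apply_of_le (by lia), rot_apply_of_le (by lia)]
  · have c0 := hp.content_rot (k := j) (by lia)
    have c1 := hp.content_rot (k := j + 1) (by lia)
    have c2 := hp.content_rot (k := j + 2) (by lia)
    have h0 : d * w - 1 - j = i + 2 := by lia
    have h1 : d * w - 1 - (j + 1) = i + 1 := by lia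
    have h2 : d * w - 1 - (j + 2) = i := by lia
    rw [h0] at c0
    rw [h1] at c1
    rw [h2] at c2
    have ht := h.triple
    unfold KnuthTriple Between at *
    rw [c0, c1, c2]
    simp only [rot_apply (show j < d * w by lia), rot_apply (show j + 1 < d * w by lia),
      rot_apply (show j + 2 < d * w by lia), h0, h1, h2]
    rcases ht with ⟨e1, e2, e3, hb⟩ | ⟨e1, e2, e3, hb⟩
    · rw [e1, e2, e3]
      exact Or.inr ⟨rfl, rfl, rfl, by lia⟩
    · rw [e1, e2, e3]
      exact Or.inl ⟨rfl, rfl, rfl, by lia⟩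

theorem IsLinExt.rot_pass_three_inv {d w : ℕ} {p : ℕ → ℕ × ℕ} (hp : IsLinExt d w p) {i j : ℕ}
    (hij : i + j + 4 = d * w) :
    RectTableau.rot d w ((RectTableau.pass i 3)⁻¹ p) =
      RectTableau.pass j 3 (RectTableau.rot d w p) := by
  simp only [RectTableau.pass, mul_inv_rev, toggle_inv, inv_one, Equiv.Perm.mul_apply,
    Equiv.Perm.one_apply, add_zero]
  rw [IsLinExt.rot_toggle (j := j + 2) _ (by lia), IsLinExt.rot_toggle (j := j + 1) _ (by lia),
    IsLinExt.rot_toggle (j := j) hp (by lia)]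
  · exact hp.toggle (by lia)
  · exact (hp.toggle (by lia)).toggle (by lia)

/-- Conjugation by rotation turns the inverse pass into a pass, so `Knuth.pass_three` applies and no
second case analysis is required. -/
theorem Knuth.pass_three_inv {d w i : ℕ} {p q : ℕ → ℕ × ℕ} (hp : IsLinExt d w p)
    (hq : IsLinExt d w q) (hi : i + 3 < d * w) (h : Knuth i p q) :
    Knuth (i + 1) ((RectTableau.pass i 3)⁻¹ p) ((RectTableau.pass i 3)⁻¹ q) := by
  obtain ⟨j, hj⟩ : ∃ j, i + j + 4 = d * w := ⟨d * w - 4 - i, by lia⟩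
  have h1 : Knuth (j + 1) (RectTableau.rot d w p) (RectTableau.rot d w q) :=
    h.rot hp (by lia)
  have h2 := h1.pass_three hp.rot hq.rot (by lia)
  have h3 := h2.rot (j := i + 1) (hp.rot.pass (by lia)) (by lia)
  rw [← hp.rot_pass_three_inv hj, ← hq.rot_pass_three_inv hj, (hp.pass_inv (by lia)).rot_rot,
    (hq.pass_inv (by lia)).rot_rot] at h3
  exact h3

/-- Of the whole pass only the three toggles starting at `i` matter: the earlier ones act before the
triple, the later ones after its new position. -/
theorem Knuth.pass_zero {d w i n : ℕ} {p q : ℕ → ℕ × ℕ} (hp : IsLinExt d w p)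
    (hq : IsLinExt d w q) (hi : i + 3 ≤ n) (hn : n < d * w) (h : Knuth (i + 1) p q) :
    Knuth i (RectTableau.pass 0 n p) (RectTableau.pass 0 n q) := by
  obtain ⟨r, rfl⟩ := Nat.exists_eq_add_of_le hi
  rw [pass_add, pass_add, zero_add, zero_add]
  exact ((h.pass (by lia)).pass_three (hp.pass (by lia)) (hq.pass (by lia)) (by lia)).pass
    (by lia)

theorem Knuth.pass_zero_inv {d w i : ℕ} {p q : ℕ → ℕ × ℕ} (hp : IsLinExt d w p)
    (hq : IsLinExt d w q) (hi : i + 3 < d * w) (h : Knuth i p q) :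
    Knuth (i + 1) ((RectTableau.pass 0 (i + 3))⁻¹ p) ((RectTableau.pass 0 (i + 3))⁻¹ q) := by
  rw [pass_add, zero_add, mul_inv_rev]
  exact (h.pass_three_inv hp hq hi).pass_inv (by lia)

theorem IsLinExt.near_zero_one {d w : ℕ} {p : ℕ → ℕ × ℕ} (hp : IsLinExt d w p)
    (h : 1 < d * w) : Near (p 0) (p 1) := by
  rw [hp.near_succ_iff h, hp.apply_zero]
  exact bot_le

theorem evac_two : evac 2 = toggle 0 := by
  simp [evac, pass]

theorem evac_three : evac 3 = toggle 0 * (toggle 1 * toggle 0) := by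
  simp [evac, pass]

/-- The first two boxes are always near, so `toggle 0` acts trivially and `evac 3` reduces to
`toggle 1`, which exchanges the two partners. -/
theorem Knuth.evac_three {d w : ℕ} {p q : ℕ → ℕ × ℕ} (hp : IsLinExt d w p)
    (hq : IsLinExt d w q) (hn : 3 ≤ d * w) (h : Knuth 0 p q) :
    Knuth 0 (evac 3 p) (evac 3 q) := by
  have np := hp.near_zero_one (by lia)
  have nq := hq.near_zero_one (by lia)
  have key : ∀ {p q : ℕ → ℕ × ℕ}, Knuth 0 p q → Near (p 0) (p 1) → Near (q 0) (q 1) →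
      evac 3 p = q := by
    intro p q h np nq
    rw [RectTableau.evac_three, Equiv.Perm.mul_apply, Equiv.Perm.mul_apply,
      toggle_of_near (p := p) np]
    rcases h.triple with ⟨e1, e2, e3, hb⟩ | ⟨e1, e2, e3, hb⟩
    · have : RectTableau.toggle 1 p = q := by
        rw [toggle_of_not_near (by simp only [zero_add] at hb; unfold Near Between at *; lia)]
        ext1 k
        simp only [zero_add] at *
        by_cases h1 : k = 1
        · subst h1; simp [e2]
        by_cases h2 : k = 2
        · subst h2; simp [e3]
        rw [Function.comp_apply, Equiv.swap_apply_of_ne_of_ne h1 h2]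
        by_cases h0 : k = 0
        · subst h0; simp [e1]
        exact (h.apply_eq k h0 h1 h2).symm
      rw [this, toggle_of_near nq]
    · simp only [zero_add] at *
      unfold Near Between at *
      lia
  rw [key h np nq, key h.symm nq np]
  exact h.symm

/-- Evacuation reverses elementary dual equivalences. -/
theorem Knuth.evac {d w n : ℕ} (hn : n ≤ d * w) {i j : ℕ} (hij : i + j + 3 = n)
    {p q : ℕ → ℕ × ℕ} (hp : IsLinExt d w p) (hq : IsLinExt d w q) (h : Knuth i p q) :
    Knuth j (evac n p) (evac n q) := by
  induction n generalizing i j p q with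
  | zero => lia
  | succ n ih =>
    -- For positive `i` the first promotion lowers the place by one. For `i = 0` the other recursion
    -- of `evac` is used, whose inverse pass raises the resulting place by one. If both places are
    -- zero, three boxes remain.
    rcases i with _ | i
    · rcases j with _ | j
      · obtain rfl : n = 2 := by lia
        exact h.evac_three hp hq hn
      · obtain rfl : n = j + 3 := by lia
        rw [evac_succ']
        exact (ih (by lia) (by lia) hp hq h).pass_zero_inv (hp.evac (by lia))
          (hq.evac (by lia)) (by lia)
    · exact ih (by lia) (by lia) (hp.pass (by lia)) (hq.pass (by lia))
        (h.pass_zero hp hq (by lia) (by lia))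

/-! ### Descents under evacuation. -/

/-- The box at place `i + 1` has smaller content than that at place `i`. -/
def Descent (i : ℕ) (p : ℕ → ℕ × ℕ) : Prop := content (p (i + 1)) < content (p i)

theorem descent_pass_two {d w i : ℕ} {p : ℕ → ℕ × ℕ} (hp : IsLinExt d w p)
    (hi : i + 2 < d * w) : Descent i (pass i 2 p) ↔ Descent (i + 1) p := by
  obtain ⟨h1, h2, -⟩ := pass_two_apply i p
  unfold Descent
  rw [h1, h2]
  exact passed_lt_iff (hp.content_ne_succ (by lia)) (hp.content_ne_add_two hi)
    (hp.content_ne_succ (by lia))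

theorem descent_pass {i s m : ℕ} (h : s + m < i ∨ i + 2 ≤ s) (p : ℕ → ℕ × ℕ) :
    Descent i (pass s m p) ↔ Descent i p := by
  unfold Descent
  rw [pass_apply_of_lt_or_lt (by lia), pass_apply_of_lt_or_lt (by lia)]

theorem descent_pass_zero {d w i n : ℕ} {p : ℕ → ℕ × ℕ} (hp : IsLinExt d w p)
    (hi : i + 2 ≤ n) (hn : n < d * w) : Descent i (pass 0 n p) ↔ Descent (i + 1) p := by
  obtain ⟨r, rfl⟩ := Nat.exists_eq_add_of_le hi
  rw [pass_add, pass_add, zero_add, zero_add]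
  exact (descent_pass (by lia) _).trans
    ((descent_pass_two (hp.pass (by lia)) (by lia)).trans (descent_pass (by lia) _))

/-- Evacuation reverses the descents. -/
theorem descent_evac {d w n : ℕ} (hn : n ≤ d * w) {i j : ℕ} (hij : i + j + 2 = n)
    {p : ℕ → ℕ × ℕ} (hp : IsLinExt d w p) : Descent j (evac n p) ↔ Descent i p := by
  induction n generalizing i j p with
  | zero => lia
  | succ n ih =>
    rcases i with _ | i
    · rcases j with _ | j
      · obtain rfl : n = 1 := by lia
        rw [evac_two, toggle_of_near (hp.near_zero_one (by lia))]
      · obtain rfl : n = j + 2 := by lia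
        rw [evac_succ', Equiv.Perm.mul_apply]
        have hq := (hp.evac (n := j + 2) (by lia)).pass_inv (s := 0) (m := j + 2) (by lia)
        rw [← descent_pass_zero hq le_rfl (by lia), ← Equiv.Perm.mul_apply (pass 0 (j + 2)),
          mul_inv_cancel, Equiv.Perm.one_apply]
        exact ih (by lia) (by lia) hp
    · exact (ih (by lia) (by lia) (hp.pass (by lia))).trans
        (descent_pass_zero hp (by lia) (by lia))

/-! ### Connectedness under dual equivalence. -/

/-- A box that is maximal among the boxes up to place `m` can be moved to place `m`. -/
theorem IsLinExt.exists_move {d w : ℕ} {p : ℕ → ℕ × ℕ} (hp : IsLinExt d w p) {k m : ℕ}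
    (hkm : k ≤ m) (hm : m < d * w) (h : ∀ j, k < j → j ≤ m → ¬ p k ≤ p j) :
    ∃ q, IsLinExt d w q ∧ (∀ j, m < j → q j = p j) ∧ q m = p k ∧
      ∀ j ≤ m, ∃ l ≤ m, q j = p l := by
  obtain ⟨n, hn⟩ : ∃ n, m = k + n := ⟨m - k, by lia⟩
  induction n generalizing k p with
  | zero =>
    obtain rfl : m = k := hn
    exact ⟨p, hp, fun _ _ => rfl, rfl, fun j hj => ⟨j, hj, rfl⟩⟩
  | succ n ih =>
    have hs := hp.swap (i := k) (by lia) (h (k + 1) (by lia) (by lia))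
    have e1 : (p ∘ Equiv.swap k (k + 1)) (k + 1) = p k := by simp
    have e2 : ∀ j, k + 1 < j → (p ∘ Equiv.swap k (k + 1)) j = p j := fun j hj => by
      rw [Function.comp_apply, Equiv.swap_apply_of_ne_of_ne (by lia) (by lia)]
    obtain ⟨q, h1, h2, h3, h4⟩ := ih hs (k := k + 1) (by lia)
      (fun j h1 h2 => by rw [e1, e2 j h1]; exact h j (by lia) h2) (by lia)
    refine ⟨q, h1, fun j hj => by rw [h2 j hj, e2 j (by lia)], by rw [h3, e1], fun j hj => ?_⟩
    obtain ⟨l, hl, e⟩ := h4 j hj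
    refine ⟨Equiv.swap k (k + 1) l, ?_, e⟩
    rw [Equiv.swap_apply_def]
    split_ifs <;> lia

/-- Two linear extensions that agree after place `n` and end at place `n` with different boxes can
be joined through an elementary dual equivalence of linear extensions with these ends. -/
theorem IsLinExt.exists_knuth {d w n : ℕ} {p q : ℕ → ℕ × ℕ} (hp : IsLinExt d w p)
    (hq : IsLinExt d w q) (hn : n < d * w) (h : ∀ j, n < j → p j = q j)
    (hlt : (p n).1 < (q n).1) :
    ∃ i p' q', i + 2 = n ∧ IsLinExt d w p' ∧ IsLinExt d w q' ∧ Knuth i p' q' ∧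
      (∀ j, n ≤ j → p' j = p j) ∧ ∀ j, n ≤ j → q' j = q j := by
  have sub : ∀ {p q : ℕ → ℕ × ℕ}, IsLinExt d w p → IsLinExt d w q → (∀ j, n < j → p j = q j) →
      ∀ j ≤ n, ∃ l ≤ n, p j = q l := by
    intro p q hp hq h j hj
    obtain ⟨l, hl, e⟩ := hq.surj (hp.mem j (by lia))
    refine ⟨l, ?_, e.symm⟩
    by_contra hc
    rw [← h l (by lia)] at e
    have := hp.inj hl (by lia) e
    lia
  have maxp : ∀ j ≤ n, p n ≤ p j → j = n := fun j hj hle => by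
    have := hp.le_of_le n hn j (by lia) hle; lia
  have maxq : ∀ j ≤ n, q n ≤ p j → p j = q n := fun j hj hle => by
    obtain ⟨l, hl, e⟩ := sub hp hq h j hj
    rw [e] at hle ⊢
    have := hq.le_of_le n hn l (by lia) hle
    rw [show l = n by lia]
  -- move `q n` next to the end
  obtain ⟨k, hk, ek⟩ := sub hq hp (fun j hj => (h j hj).symm) n le_rfl
  have hkn : k ≠ n := by rintro rfl; rw [ek] at hlt; exact lt_irrefl _ hlt
  obtain ⟨r, hr, r1, r2, r3⟩ := hp.exists_move (k := k) (m := n - 1) (by lia) (by lia)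
    (fun j h1 h2 hle => by
      have := hp.inj (by lia) (by lia) (maxq j (by lia) (ek ▸ hle) |>.trans ek)
      lia)
  have rn : r n = p n := r1 n (by lia)
  -- the columns of the two ends
  have hcol : (q n).2 < (p n).2 := by
    by_contra hc
    exact hkn (maxp k hk (ek ▸ Prod.le_def.mpr ⟨hlt.le, by lia⟩))
  -- a box between the two ends
  have hex : ∃ z < n - 1, (q n).1 - 1 ≤ (r z).1 ∧ (q n).2 ≤ (r z).2 := by
    obtain ⟨z, hz, ez⟩ := hr.exists_of_le (l := n - 1) (x := ((q n).1 - 1, (q n).2)) (by lia)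
      (by rw [r2, ← ek]; exact ⟨by simp, le_rfl⟩)
    refine ⟨z, lt_of_le_of_ne hz ?_, by rw [ez], by rw [ez]⟩
    rintro rfl
    rw [r2, ← ek] at ez
    have := congrArg Prod.fst ez
    simp only at this
    lia
  classical
  -- The last such box has no larger box after it before place `n - 1`, so it can be moved to place
  -- `n - 2`.
  obtain ⟨z, ⟨hz, hz1, hz2⟩, hzmax⟩ : ∃ z, (z < n - 1 ∧ (q n).1 - 1 ≤ (r z).1 ∧
      (q n).2 ≤ (r z).2) ∧ ∀ j, z < j → j < n - 1 →
        ¬ ((q n).1 - 1 ≤ (r j).1 ∧ (q n).2 ≤ (r j).2) := by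
    obtain ⟨z, hz, hz'⟩ := hex
    let P := fun j => j < n - 1 ∧ (q n).1 - 1 ≤ (r j).1 ∧ (q n).2 ≤ (r j).2
    refine ⟨Nat.findGreatest P n, Nat.findGreatest_spec (P := P) (m := z) (by lia) ⟨hz, hz'⟩,
      fun j h1 h2 h3 => ?_⟩
    exact Nat.findGreatest_is_greatest (P := P) h1 (by lia) ⟨h2, h3⟩
  have hzrow : (r z).1 = (q n).1 - 1 := by
    by_contra hc
    have := hr.le_of_le (n - 1) (by lia) z (by lia)
      (by rw [r2, ← ek]; exact Prod.le_def.mpr ⟨by lia, hz2⟩)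
    lia
  have hzcol : (r z).2 < (p n).2 := by
    by_contra hc
    have := hr.le_of_le n (by lia) z (by lia)
      (by rw [rn]; exact Prod.le_def.mpr ⟨by lia, by lia⟩)
    lia
  obtain ⟨s, hs, s1, s2, -⟩ := hr.exists_move (k := z) (m := n - 2) (by lia) (by lia)
    (fun j h1 h2 hle => hzmax j h1 (by lia) ⟨hz1.trans hle.1, hz2.trans hle.2⟩)
  obtain ⟨i, rfl⟩ : ∃ i, n = i + 2 := ⟨n - 2, by lia⟩
  have si : s i = r z := s2
  have s3 : s (i + 1) = q (i + 2) := by rw [s1 _ (by lia), ek]; exact r2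
  have s4 : s (i + 2) = p (i + 2) := by rw [s1 _ (by lia), rn]
  -- The box `r z` lies one row above `q n` and not to its left, and strictly left of `p n` and not
  -- above it; its content is therefore strictly between theirs.
  have hb : Between (s (i + 1)) (s i) (s (i + 2)) := by
    rw [s3, s4, si]
    unfold Between content
    lia
  have hle : ¬ s (i + 1) ≤ s (i + 1 + 1) := by
    rw [s3]
    change ¬ _ ≤ s (i + 2)
    rw [s4, Prod.le_def]
    lia
  refine ⟨i, s, s ∘ Equiv.swap (i + 1) (i + 1 + 1), rfl, hs, hs.swap (by lia) hle, ⟨?_, ?_⟩,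
    ?_, ?_⟩
  · intro j h1 h2 h3
    rw [Function.comp_apply, Equiv.swap_apply_of_ne_of_ne h2 h3]
  · refine Or.inl ⟨?_, ?_, ?_, hb⟩
    · rw [Function.comp_apply, Equiv.swap_apply_of_ne_of_ne (by lia) (by lia)]
    · simp
    · simp
  · intro j hj
    rcases hj.eq_or_lt with rfl | hj
    · exact s4
    · rw [s1 j (by lia), r1 j (by lia)]
  · intro j hj
    rcases hj.eq_or_lt with rfl | hj
    · simp [s3]
    · rw [Function.comp_apply, Equiv.swap_apply_of_ne_of_ne (by lia) (by lia), s1 j (by lia),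
        r1 j (by lia), h j hj]

/-- All linear extensions are connected by elementary dual equivalences. -/
theorem IsLinExt.induction_knuth {d w : ℕ} {P : (ℕ → ℕ × ℕ) → Prop}
    (hP : ∀ i p q, i + 3 ≤ d * w → IsLinExt d w p → IsLinExt d w q → Knuth i p q → P p → P q)
    {p q : ℕ → ℕ × ℕ} (hp : IsLinExt d w p) (hq : IsLinExt d w q) (h : P p) : P q := by
  have key : ∀ n ≤ d * w, ∀ p q, IsLinExt d w p → IsLinExt d w q →
      (∀ j, n ≤ j → p j = q j) → P p → P q := by
    intro n
    induction n with
    | zero =>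
      intro _ p q _ _ h hp
      rwa [← show p = q from funext fun j => h j (Nat.zero_le j)]
    | succ n ih =>
      intro hn p q hp hq h hPp
      rcases lt_trichotomy (p n).1 (q n).1 with hlt | heq | hlt
      · obtain ⟨i, p', q', hi, hp', hq', hk, h1, h2⟩ :=
          hp.exists_knuth hq (by lia) h hlt
        have e1 := ih (by lia) p p' hp hp' (fun j hj => (h1 j hj).symm) hPp
        exact ih (by lia) q' q hq' hq h2 (hP i p' q' (by lia) hp' hq' hk e1)
      -- Ends in the same row are comparable; each is maximal in the same set of remaining boxes, so
      -- they coincide.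
      · refine ih (by lia) p q hp hq (fun j hj => ?_) hPp
        rcases hj.eq_or_lt with rfl | hj
        · have hcmp : p n ≤ q n ∨ q n ≤ p n := by
            rw [Prod.le_def, Prod.le_def]; lia
          rcases hcmp with hc | hc
          · obtain ⟨k, hk, e⟩ := hq.exists_of_le (by lia) hc
            by_contra hne
            obtain ⟨l, hl, e'⟩ := hp.surj (hq.mem n (by lia))
            have h3 := hp.le_of_le n (by lia) l hl (e' ▸ hc)
            have h4 : l ≠ n := by rintro rfl; exact hne e'
            rw [h l (by lia)] at e'
            have := hq.inj hl (by lia) e'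
            lia
          · by_contra hne
            obtain ⟨l, hl, e'⟩ := hq.surj (hp.mem n (by lia))
            have h3 := hq.le_of_le n (by lia) l hl (e' ▸ hc)
            have h4 : l ≠ n := by rintro rfl; exact hne e'.symm
            rw [← h l (by lia)] at e'
            have := hp.inj hl (by lia) e'
            lia
        · exact h j hj
      · obtain ⟨i, q', p', hi, hq', hp', hk, h2, h1⟩ :=
          hq.exists_knuth hp (by lia) (fun j hj => (h j hj).symm) hlt
        have e1 := ih (by lia) p p' hp hp' (fun j hj => (h1 j hj).symm) hPp
        exact ih (by lia) q' q hq' hq h2 (hP i p' q' (by lia) hp' hq' hk.symm e1)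
  exact key (d * w) le_rfl p q hp hq (fun j hj => by rw [hp.zero j hj, hq.zero j hj]) h

/-! ### The row reading, and evacuation as rotation. -/

/-- The boxes of the `d × w` rectangle, row by row. -/
def rowReading (d w : ℕ) : ℕ → ℕ × ℕ := fun k => if k < d * w then (k / w, k % w) else 0

theorem rowReading_apply {d w k : ℕ} (hk : k < d * w) : rowReading d w k = (k / w, k % w) :=
  if_pos hk

theorem isLinExt_rowReading (d w : ℕ) : IsLinExt d w (rowReading d w) := by
  refine ⟨fun k hk => ?_, fun k hk l hl h => ?_, fun k hk => if_neg (by lia)⟩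
  · have hw : 0 < w := Nat.pos_of_ne_zero (by rintro rfl; simp at hk)
    rw [rowReading_apply hk, mem_rect]
    exact ⟨Nat.div_lt_of_lt_mul (by rwa [mul_comm]), Nat.mod_lt k hw⟩
  · rw [rowReading_apply hk, rowReading_apply hl] at h
    rw [← Nat.div_add_mod k w, ← Nat.div_add_mod l w]
    exact Nat.add_le_add (Nat.mul_le_mul_left w h.1) h.2

theorem rowReading_succ {d w k : ℕ} (hk : k + 1 < d * w) (h : (k + 1) % w ≠ 0) :
    rowReading d w (k + 1) = ((rowReading d w k).1, (rowReading d w k).2 + 1) := by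
  have hd : ¬ w ∣ k + 1 := fun h' => h (Nat.mod_eq_zero_of_dvd h')
  have h1 := Nat.div_add_mod (k + 1) w
  have h2 := Nat.div_add_mod k w
  rw [Nat.succ_div_of_not_dvd hd] at h1
  rw [rowReading_apply hk, rowReading_apply (by lia), Nat.succ_div_of_not_dvd hd]
  ext <;> simp only
  lia

/-- The row reading is the only linear extension all of whose descents are at the ends of
rows. -/
theorem eq_rowReading {d w : ℕ} {p : ℕ → ℕ × ℕ} (hp : IsLinExt d w p)
    (h : ∀ i, i + 1 < d * w → (i + 1) % w ≠ 0 → ¬ Descent i p) : p = rowReading d w := by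
  have hr := isLinExt_rowReading d w
  ext1 k
  by_cases hk : k < d * w
  swap
  · rw [hp.zero k (by lia), hr.zero k (by lia)]
  have hw : 0 < w := Nat.pos_of_ne_zero (by rintro rfl; simp at hk)
  induction k using Nat.strong_induction_on with
  | _ k ih =>
    obtain ⟨m, hm, em⟩ := hr.surj (hp.mem k hk)
    have hkm : k ≤ m := by
      by_contra hc
      rw [← ih m (by lia) hm] at em
      have := hp.inj hm hk em
      lia
    -- If `p` first deviates at place `k`, the skipped box `rowReading d w k` comes later in `p`, so
    -- it cannot lie below `p k` in the order.
    have hle : ¬ (rowReading d w k ≤ p k ∧ k ≠ m) := by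
      rintro ⟨h1, h2⟩
      obtain ⟨j, hj, e⟩ := hp.exists_of_le hk h1
      rcases hj.eq_or_lt with rfl | hj
      · rw [← em] at e
        exact h2 (hr.inj hk hm e.symm)
      · rw [ih j hj (by lia)] at e
        have := hr.inj (by lia) hk e
        lia
    by_cases hkm' : k = m
    · rw [hkm', em, ← hkm']
    exfalso
    have h1 : k / w ≤ m / w := Nat.div_le_div_right hkm
    have h2 := Nat.div_add_mod k w
    have h3 := Nat.div_add_mod m w
    rw [rowReading_apply hm] at em
    rw [rowReading_apply hk, ← em, Prod.le_def] at hle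
    have h4 : m % w < k % w ∧ k / w < m / w := by
      have h5 : m % w < k % w := by
        by_contra hc
        exact hle ⟨⟨h1, by simpa using hc⟩, hkm'⟩
      refine ⟨h5, h1.lt_of_ne fun h6 => ?_⟩
      rw [h6] at h2
      lia
    obtain ⟨k, rfl⟩ : ∃ j, k = j + 1 := ⟨k - 1, by
      rcases k with _ | k
      · simp at h4
      · rfl⟩
    -- `p k` is the left neighbour of the skipped box, whereas the next box of `p` is in a lower row
    -- and strictly left of the skipped one: a descent that is not at the end of a row.
    refine h k hk (by lia) ?_
    have h6 := rowReading_succ hk (by lia)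
    rw [rowReading_apply hk, Prod.ext_iff] at h6
    unfold Descent content
    rw [ih k (by lia) (by lia), ← em]
    lia

/-- Evacuation of a rectangle is rotation by 180°. -/
theorem IsLinExt.evac_eq_rot {d w : ℕ} {p : ℕ → ℕ × ℕ} (hp : IsLinExt d w p) :
    RectTableau.evac (d * w) p = RectTableau.rot d w p := by
  have hr := isLinExt_rowReading d w
  refine induction_knuth (P := fun p => RectTableau.evac (d * w) p = RectTableau.rot d w p)
    (fun i p q hi hp hq h e => ?_) hr hp ?_
  · have h1 := h.evac (j := d * w - 3 - i) le_rfl (by lia) hp hq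
    have h2 := h.rot (j := d * w - 3 - i) hp (by lia)
    rw [e] at h1
    exact h1.unique h2
  · have desc : ∀ i, i + 1 < d * w → (i + 1) % w ≠ 0 → ¬ Descent i (rowReading d w) := by
      intro i hi h1
      unfold Descent content
      rw [rowReading_succ hi h1]
      push_cast
      lia
    -- The set of row ends is symmetric under reversal, because `(i + 1) + (j + 1) = d * w` is a
    -- multiple of `w`.
    have hdvd : ∀ i j, i + j + 2 = d * w → (i + 1) % w ≠ 0 → (j + 1) % w ≠ 0 := by
      intro i j hij h1 h2
      refine h1 (Nat.mod_eq_zero_of_dvd ?_)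
      refine (Nat.dvd_add_left (Nat.dvd_of_mod_eq_zero h2)).mp ⟨d, ?_⟩
      lia
    have e1 : RectTableau.evac (d * w) (rowReading d w) = rowReading d w := by
      refine eq_rowReading (hr.evac le_rfl) fun i hi h1 => ?_
      rw [descent_evac (i := d * w - 2 - i) le_rfl (by lia) hr]
      exact desc _ (by lia) (hdvd i _ (by lia) h1)
    have e2 : RectTableau.rot d w (rowReading d w) = rowReading d w := by
      refine eq_rowReading hr.rot fun i hi h1 => ?_
      have := desc _ (by lia) (hdvd i (d * w - 2 - i) (by lia) h1)
      unfold Descent at *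
      rw [hr.content_rot hi, hr.content_rot (by lia)]
      rw [show d * w - 2 - i + 1 = d * w - 1 - i by lia] at this
      rw [show d * w - 1 - (i + 1) = d * w - 2 - i by lia]
      lia
    rw [e1, e2]

/-! ### Slides of fillings as passes of sequences. -/

/-- The filling `T` of the `d × w` rectangle has the entry `v k` in the box `p k`. -/
structure Reads (d w : ℕ) (T : ℕ × ℕ → ℕ) (p : ℕ → ℕ × ℕ) (v : ℕ → ℕ) : Prop where
  apply_eq : ∀ k < d * w, T (p k) = v k
  zero : ∀ x, x ∉ rect d w → T x = 0

theorem Reads.congr {d w : ℕ} {T : ℕ × ℕ → ℕ} {p : ℕ → ℕ × ℕ} {v v' : ℕ → ℕ}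
    (h : Reads d w T p v) (hv : ∀ k < d * w, v k = v' k) : Reads d w T p v' :=
  ⟨fun k hk => by rw [h.apply_eq k hk, hv k hk], h.zero⟩

theorem Reads.eq {d w : ℕ} {T T' : ℕ × ℕ → ℕ} {p : ℕ → ℕ × ℕ} {v : ℕ → ℕ}
    (hp : IsLinExt d w p) (h : Reads d w T p v) (h' : Reads d w T' p v) : T = T' := by
  ext1 x
  by_cases hx : x ∈ rect d w
  · obtain ⟨k, hk, rfl⟩ := hp.surj hx
    rw [h.apply_eq k hk, h'.apply_eq k hk]
  · rw [h.zero x hx, h'.zero x hx]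

theorem Reads.update {d w : ℕ} {T : ℕ × ℕ → ℕ} {p : ℕ → ℕ × ℕ} {v : ℕ → ℕ}
    (hp : IsLinExt d w p) (h : Reads d w T p v) {k : ℕ} (hk : k < d * w) (a : ℕ) :
    Reads d w (Function.update T (p k) a) p (Function.update v k a) := by
  refine ⟨fun l hl => ?_, fun x hx => ?_⟩
  · by_cases hlk : l = k
    · rw [hlk, Function.update_self, Function.update_self]
    · rw [Function.update_of_ne hlk, Function.update_of_ne, h.apply_eq l hl]
      exact fun e => hlk (hp.inj hl hk e)
  · rw [Function.update_of_ne, h.zero x hx]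
    rintro rfl
    exact hx (hp.mem k hk)

/-- The entries `v` after the `s`-th one has been moved past the next `m` ones. -/
def shift (v : ℕ → ℕ) (s m : ℕ) : ℕ → ℕ := fun k =>
  if s ≤ k ∧ k < s + m then v (k + 1) else if k = s + m then v s else v k

theorem shift_swap (v : ℕ → ℕ) (s m : ℕ) :
    shift (v ∘ Equiv.swap s (s + 1)) (s + 1) m = shift v s (m + 1) := by
  ext1 k
  unfold shift
  simp only [Function.comp_apply, Equiv.swap_apply_def]
  split_ifs <;> first | rfl | lia

/-- A value occurring only in boxes that the sliding box has left behind does not matter. -/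
theorem iterate_slideStep_succ {I : Set (ℕ × ℕ)} (hI : IsLowerSet I) {a : ℕ} (c n : ℕ)
    {T : ℕ × ℕ → ℕ} {b : ℕ × ℕ} (hT : ∀ x, T x = a → x ∈ I) (hb : b ∉ I) :
    (slideStep a c)^[n] (T, b) = (slideStep (a + 1) c)^[n] (T, b) := by
  induction n generalizing T b with
  | zero => rfl
  | succ n ih =>
    have hE : (b.1, b.2 + 1) ∉ I := fun h =>
      hb (hI (show b ≤ (b.1, b.2 + 1) from ⟨le_rfl, Nat.le_succ _⟩) h)
    have hS : (b.1 + 1, b.2) ∉ I := fun h =>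
      hb (hI (show b ≤ (b.1 + 1, b.2) from ⟨Nat.le_succ _, le_rfl⟩) h)
    have iE : T (b.1, b.2 + 1) ∈ Finset.Icc a c ↔ T (b.1, b.2 + 1) ∈ Finset.Icc (a + 1) c := by
      have : T (b.1, b.2 + 1) ≠ a := fun h => hE (hT _ h)
      simp only [Finset.mem_Icc]
      lia
    have iS : T (b.1 + 1, b.2) ∈ Finset.Icc a c ↔ T (b.1 + 1, b.2) ∈ Finset.Icc (a + 1) c := by
      have : T (b.1 + 1, b.2) ≠ a := fun h => hS (hT _ h)
      simp only [Finset.mem_Icc]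
      lia
    have hs : slideStep a c (T, b) = slideStep (a + 1) c (T, b) := by
      unfold slideStep
      simp only [iE, iS]
    have hmove : ∀ b', b' ∉ I → ∀ x, (T ∘ Equiv.swap b b') x = a → x ∈ I := by
      intro b' hb' x hx
      have := hT _ hx
      rw [Equiv.swap_apply_def] at this
      split_ifs at this with h1 h2
      · exact absurd this hb'
      · exact absurd this hb
      · exact this
    rw [Function.iterate_succ_apply, Function.iterate_succ_apply, ← hs]
    unfold slideStep
    split_ifs
    · exact ih (hmove _ hE) hE
    · exact ih (hmove _ hS) hS
    · exact ih hT hb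

/-- The entry `a` is the smallest in the range and occurs only once, so it wins against the other
neighbour. -/
theorem slideStep_of_near {a c : ℕ} {T : ℕ × ℕ → ℕ} {b b' : ℕ × ℕ} (hac : a ≤ c)
    (hb : b' = (b.1, b.2 + 1) ∨ b' = (b.1 + 1, b.2)) (hT : T b' = a)
    (hu : ∀ x, T x = a → x = b') :
    slideStep a c (T, b) = (T ∘ Equiv.swap b b', b') := by
  unfold slideStep
  simp only [Finset.mem_Icc]
  rcases hb with rfl | rfl
  · rw [if_pos]
    refine ⟨by lia, fun h => ?_⟩
    have : T (b.1 + 1, b.2) ≠ a := fun h' => by simpa using congrArg Prod.fst (hu _ h')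
    lia
  · rw [if_neg, if_pos (by lia)]
    lia

theorem IsLinExt.isLowerSet {d w : ℕ} {p : ℕ → ℕ × ℕ} (hp : IsLinExt d w p) {s : ℕ}
    (hs : s < d * w) : IsLowerSet {x | ∃ k ≤ s, p k = x} := by
  rintro x y hyx ⟨k, hk, rfl⟩
  obtain ⟨l, hl, rfl⟩ := hp.exists_of_le (by lia) hyx
  exact ⟨l, by lia, rfl⟩

/-- Sliding the box at place `s` through the following `m` entries. -/
theorem Reads.iterate_slideStep {d w : ℕ} {T : ℕ × ℕ → ℕ} {p : ℕ → ℕ × ℕ} {v : ℕ → ℕ}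
    {s m a c n : ℕ} (hp : IsLinExt d w p) (h : Reads d w T p v) (hs : s + m < d * w)
    (ha : 0 < a) (hc : c + 1 = a + m) (hv : ∀ j < m, v (s + 1 + j) = a + j)
    (hv' : ∀ k < d * w, a ≤ v k → v k ≤ c → s + 1 ≤ k ∧ k ≤ s + m) (hn : m ≤ n) :
    ∃ T', (slideStep a c)^[n] (T, p s) = (T', pass s m p (s + m)) ∧
      Reads d w T' (pass s m p) (shift v s m) := by
  induction m generalizing T p v s a n with
  | zero =>
    refine ⟨T, ?_, h.congr fun k _ => ?_⟩
    · have hfix : ∀ st, slideStep a c st = st := by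
        intro st
        unfold slideStep
        simp only [Finset.mem_Icc]
        rw [if_neg (by lia), if_neg (by lia)]
      rw [Function.iterate_fixed (hfix _)]
      rfl
    · unfold shift
      split_ifs with h1 h2
      · lia
      · rw [h2, add_zero]
      · rfl
  | succ m ih =>
    have hs1 : s + 1 < d * w := by lia
    have hp' : IsLinExt d w (toggle s p) := hp.toggle hs1
    have hva : v (s + 1) = a := hv 0 (by lia)
    have hvu : ∀ k < d * w, v k = a → k = s + 1 := by
      intro k hk e
      obtain ⟨h1, h2⟩ := hv' k hk e.ge (by lia)
      have := hv (k - (s + 1)) (by lia)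
      rw [show s + 1 + (k - (s + 1)) = k by lia] at this
      lia
    have hTu : ∀ x, T x = a → x = p (s + 1) := by
      intro x hx
      by_cases hxr : x ∈ rect d w
      · obtain ⟨k, hk, rfl⟩ := hp.surj hxr
        rw [h.apply_eq k hk] at hx
        rw [hvu k hk hx]
      · rw [h.zero x hxr] at hx; lia
    -- Once the entry `a` has been dealt with it lies behind the sliding box, and what remains is a
    -- slide from place `s + 1` through `[a + 1, c]`.
    have main : ∀ T1, Reads d w T1 (toggle s p) (v ∘ Equiv.swap s (s + 1)) →
        ∀ n, m ≤ n → ∃ T', (slideStep a c)^[n] (T1, toggle s p (s + 1)) =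
          (T', pass s (m + 1) p (s + (m + 1))) ∧
          Reads d w T' (pass s (m + 1) p) (shift v s (m + 1)) := by
      intro T1 h1 n hn
      rw [iterate_slideStep_succ (hp'.isLowerSet (s := s) (by lia))]
      · obtain ⟨T', e1, e2⟩ := ih (s := s + 1) (a := a + 1) hp' h1 (by lia) (by lia) (by lia)
          (fun j hj => by
            rw [Function.comp_apply, Equiv.swap_apply_of_ne_of_ne (by lia) (by lia)]
            have := hv (j + 1) (by lia)
            rw [show s + 1 + (j + 1) = s + 1 + 1 + j by lia] at this
            lia)
          (fun k hk h2 h3 => by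
            simp only [Function.comp_apply, Equiv.swap_apply_def] at h2 h3
            split_ifs at h2 h3 with h4 h5
            · lia
            · have := hv' s (by lia) (by lia) h3; lia
            · have := hv' k hk (by lia) h3; lia) hn
        rw [shift_swap] at e2
        refine ⟨T', ?_, ?_⟩
        · rw [e1, pass_succ', Equiv.Perm.mul_apply, show s + 1 + m = s + (m + 1) by lia]
        · rwa [pass_succ', Equiv.Perm.mul_apply]
      · intro x hx
        by_cases hxr : x ∈ rect d w
        · obtain ⟨k, hk, rfl⟩ := hp'.surj hxr
          rw [h1.apply_eq k hk, Function.comp_apply] at hx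
          refine ⟨k, ?_, rfl⟩
          have h3 := hvu _ (by rw [Equiv.swap_apply_def]; split_ifs <;> lia) hx
          rw [Equiv.swap_apply_def] at h3
          split_ifs at h3 <;> lia
        · rw [h1.zero x hxr] at hx; lia
      · rintro ⟨k, hk, e⟩
        have := hp'.inj (by lia) (by lia) e
        lia
    -- In the near case the filling changes and the sequence does not. Otherwise the sequence
    -- changes and the filling does not, and no sliding step is spent; this is why only `m ≤ n` is
    -- assumed.
    by_cases hnear : Near (p s) (p (s + 1))
    · have ht := toggle_of_near hnear
      rw [ht] at main
      obtain ⟨n, rfl⟩ : ∃ j, n = j + 1 := ⟨n - 1, by lia⟩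
      rw [Function.iterate_succ_apply, slideStep_of_near (by lia)
        (hp.eq_of_le_succ hs1 ((hp.near_succ_iff hs1).mp hnear))
        (by rw [h.apply_eq _ hs1, hva]) hTu]
      refine main _ ⟨fun k hk => ?_, fun x hx => ?_⟩ n (by lia)
      · have h1 : Equiv.swap s (s + 1) k < d * w := by
          rw [Equiv.swap_apply_def]; split_ifs <;> lia
        rw [Function.comp_apply, Function.comp_apply, ← h.apply_eq _ h1]
        congr 1
        rw [Equiv.swap_apply_def, Equiv.swap_apply_def]
        by_cases e1 : k = s
        · rw [if_pos e1, if_pos (by rw [e1])]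
        by_cases e2 : k = s + 1
        · rw [if_neg e1, if_pos e2, if_neg, if_pos (by rw [e2])]
          exact fun e => e1 (hp.inj hk (by lia) e)
        rw [if_neg e1, if_neg e2, if_neg, if_neg]
        · exact fun e => e2 (hp.inj hk hs1 e)
        · exact fun e => e1 (hp.inj hk (by lia) e)
      · rw [Function.comp_apply, Equiv.swap_apply_of_ne_of_ne, h.zero x hx]
        · rintro rfl; exact hx (hp.mem s (by lia))
        · rintro rfl; exact hx (hp.mem _ hs1)
    · have ht := toggle_of_not_near hnear
      have e : toggle s p (s + 1) = p s := by rw [ht]; simp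
      rw [← e]
      refine main T ⟨fun k hk => ?_, h.zero⟩ n (by lia)
      have h1 : Equiv.swap s (s + 1) k < d * w := by
        rw [Equiv.swap_apply_def]; split_ifs <;> lia
      rw [ht]
      exact h.apply_eq _ h1

theorem Reads.slide {d w : ℕ} {T : ℕ × ℕ → ℕ} {p : ℕ → ℕ × ℕ} {v : ℕ → ℕ}
    {s m a c : ℕ} (hp : IsLinExt d w p) (h : Reads d w T p v) (hs : s + m < d * w)
    (ha : 0 < a) (hc : c + 1 = a + m) (hv : ∀ j < m, v (s + 1 + j) = a + j)
    (hv' : ∀ k < d * w, a ≤ v k → v k ≤ c → s + 1 ≤ k ∧ k ≤ s + m) :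
    (slide a c T (p s)).2 = pass s m p (s + m) ∧
      Reads d w (slide a c T (p s)).1 (pass s m p) (shift v s m) := by
  obtain ⟨T', e1, e2⟩ := h.iterate_slideStep hp hs ha hc hv hv' (n := c + 1 - a) (by lia)
  unfold RectTableau.slide
  rw [e1]
  exact ⟨rfl, e2⟩

theorem Reads.promotion {d w i : ℕ} {T : ℕ × ℕ → ℕ} {p : ℕ → ℕ × ℕ} (hp : IsLinExt d w p)
    (h : Reads d w T p (· + 1)) (hi : i < d * w) :
    Reads d w (promotion (i + 1) T) (pass 0 i p) (· + 1) := by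
  -- The empty box carries the value 0, outside the sliding range. Places start at 0, so place `k`
  -- holds the entry `k + 1`.
  have h0 : Reads d w (Function.update T (0, 0) 0) p (Function.update (· + 1) 0 0) := by
    have := h.update hp (k := 0) (by lia) 0
    rw [hp.apply_zero] at this
    exact this
  obtain ⟨e1, e2⟩ := h0.slide hp (s := 0) (m := i) (a := 2) (c := i + 1) (by lia) (by lia)
    (by lia) (fun j hj => by rw [Function.update_of_ne (by lia)]; lia)
    (fun k hk h1 h2 => by
      by_cases hk0 : k = 0
      · rw [hk0, Function.update_self] at h1; lia
      · rw [Function.update_of_ne hk0] at h1 h2; lia)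
  rw [hp.apply_zero] at e1 e2
  unfold RectTableau.promotion
  have e3 : Reads d w (fun x => decr (i + 1) ((RectTableau.slide 2 (i + 1)
      (Function.update T (0, 0) 0) (0, 0)).1 x)) (pass 0 i p)
      (fun k => decr (i + 1) (shift (Function.update (· + 1) 0 0) 0 i k)) :=
    ⟨fun k hk => congrArg _ (e2.apply_eq k hk), fun x hx => by
      have := e2.zero x hx
      exact (congrArg (decr (i + 1)) this).trans (by simp [decr])⟩
  have e4 := e3.update (hp.pass (by lia)) (k := 0 + i) (by lia) (i + 1)
  rw [← e1] at e4
  refine e4.congr fun k hk => ?_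
  by_cases hk0 : k = 0 + i
  · rw [hk0, Function.update_self]; lia
  · rw [Function.update_of_ne hk0]
    have hv : shift (Function.update (· + 1) 0 0) 0 i k = if k < i then k + 2 else k + 1 := by
      unfold shift
      rw [if_neg hk0]
      by_cases hki : k < i
      · rw [if_pos (by lia), if_pos hki, Function.update_of_ne (by lia)]
      · rw [if_neg (by lia), if_neg hki, Function.update_of_ne (by lia)]
    rw [hv]
    unfold decr
    simp only [Finset.mem_Icc]
    split_ifs <;> lia

theorem Reads.evacuation {d w n : ℕ} {T : ℕ × ℕ → ℕ} {p : ℕ → ℕ × ℕ} (hp : IsLinExt d w p)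
    (h : Reads d w T p (· + 1)) (hn : n ≤ d * w) :
    Reads d w (evacuation n T) (evac n p) (· + 1) := by
  induction n generalizing T p with
  | zero => exact h
  | succ n ih => exact ih (hp.pass (by lia)) (h.promotion hp (by lia)) (by lia)

/-- The entries read along the boxes when the red boxes of index greater than `k` have been slid:
`1, 1, …, k, k`, then the blue `k + 1, …, M`, then the moved red entries. -/
def stageEntry (M k n : ℕ) : ℕ :=
  if n < 2 * k then n / 2 + 1 else if n < M + k then n - k + 1 else n + 1

/-- The red `k + 1` is at place `2 * k + 1`, directly followed by the `M - 1 - k` blue entries `k +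
2, …, M`; after passing them it is at place `M + k`, where the entry `k + 1 + M` belongs. -/
theorem Reads.redStep {d w M k : ℕ} {D U : ℕ × ℕ → ℕ} {p : ℕ → ℕ × ℕ} (hM : d * w = 2 * M)
    (hp : IsLinExt d w p) (h : Reads d w U p (stageEntry M (k + 1))) (hk : k < M)
    (hD : redBox d w D (k + 1) = p (2 * k + 1)) :
    Reads d w (redStep d w M D (k + 1) U) (pass (2 * k + 1) (M - 1 - k) p) (stageEntry M k) := by
  obtain ⟨e1, e2⟩ := h.slide hp (s := 2 * k + 1) (m := M - 1 - k) (a := k + 2) (c := M)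
    (by lia) (by lia) (by lia)
    (fun j hj => by unfold stageEntry; rw [if_neg (by lia), if_pos (by lia)]; lia)
    (fun n hn h1 h2 => by unfold stageEntry at h1 h2; split_ifs at h1 h2 <;> lia)
  have e3 := e2.update (hp.pass (by lia)) (k := 2 * k + 1 + (M - 1 - k)) (by lia) (k + 1 + M)
  rw [← e1, ← hD] at e3
  refine e3.congr fun n hn => ?_
  by_cases hn' : n = 2 * k + 1 + (M - 1 - k)
  · rw [hn', Function.update_self]
    unfold stageEntry
    rw [if_neg (by lia), if_neg (by lia)]
    lia
  · rw [Function.update_of_ne hn']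
    unfold shift stageEntry
    split_ifs <;> lia

theorem Reads.redSlidesFrom {d w M k : ℕ} {D U : ℕ × ℕ → ℕ} {p : ℕ → ℕ × ℕ}
    (hM : d * w = 2 * M) (hp : IsLinExt d w p) (h : Reads d w U p (stageEntry M k)) (hk : k ≤ M)
    (hD : ∀ j < k, redBox d w D (j + 1) = p (2 * j + 1)) :
    Reads d w (redSlidesFrom d w M D k U) (unshuffle M k p) (· + 1) := by
  induction k generalizing U p with
  | zero =>
    refine h.congr fun n hn => ?_
    unfold stageEntry
    split_ifs <;> lia
  | succ k ih =>
    refine ih (hp.pass (by lia)) (h.redStep hM hp (by lia) (hD k (by lia))) (by lia)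
      fun j hj => ?_
    rw [pass_apply_of_lt_or_lt (by lia), hD j (by lia)]

/-! ### Standard tableaux and their rotation. -/

theorem IsTableau.mono {d w : ℕ} {T : ℕ × ℕ → ℕ} (h : IsTableau (rect d w) T) {x y : ℕ × ℕ}
    (hxy : x ≤ y) (hy : y ∈ rect d w) : T x ≤ T y := by
  have hx := mem_rect_of_le hxy hy
  have hz : (x.1, y.2) ∈ rect d w := mem_rect_of_le (y := y) ⟨hxy.1, le_rfl⟩ hy
  exact (h.row_weak x.1 x.2 y.2 hxy.2 hx hz).trans (h.col_weak x.1 y.1 y.2 hxy.1 hz hy)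

theorem Reads.isTableau {d w : ℕ} {T : ℕ × ℕ → ℕ} {p : ℕ → ℕ × ℕ} {v : ℕ → ℕ}
    (hp : IsLinExt d w p) (h : Reads d w T p v) (hv : Monotone v) (hv0 : ∀ k, 0 < v k) :
    IsTableau (rect d w) T := by
  have key : ∀ x y, x ≤ y → x ∈ rect d w → y ∈ rect d w → T x ≤ T y := by
    intro x y hxy hx hy
    obtain ⟨k, hk, rfl⟩ := hp.surj hx
    obtain ⟨l, hl, rfl⟩ := hp.surj hy
    rw [h.apply_eq k hk, h.apply_eq l hl]
    exact hv (hp.le_of_le k hk l hl hxy)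
  refine ⟨h.zero, fun x hx => ?_, fun i j₁ j₂ hj => key _ _ ⟨le_rfl, hj⟩,
    fun i₁ i₂ j hi => key _ _ ⟨hi, le_rfl⟩⟩
  obtain ⟨k, hk, rfl⟩ := hp.surj hx
  rw [h.apply_eq k hk]
  exact hv0 k

theorem Reads.mem_SYT {d w : ℕ} {T : ℕ × ℕ → ℕ} {p : ℕ → ℕ × ℕ}
    (hp : IsLinExt d w p) (h : Reads d w T p (· + 1)) : T ∈ SYT (rect d w) := by
  refine ⟨h.isTableau hp (fun a b hab => Nat.succ_le_succ hab) fun k => Nat.succ_pos k, ?_⟩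
  ext n
  rw [card_rect, Finset.mem_image, Finset.mem_Icc]
  constructor
  · rintro ⟨x, hx, rfl⟩
    obtain ⟨k, hk, rfl⟩ := hp.surj hx
    rw [h.apply_eq k hk]
    lia
  · intro hn
    refine ⟨p (n - 1), hp.mem _ (by lia), ?_⟩
    rw [h.apply_eq _ (by lia)]
    lia

theorem exists_reads_of_mem_SYT {d w : ℕ} {T : ℕ × ℕ → ℕ} (h : T ∈ SYT (rect d w)) :
    ∃ p, IsLinExt d w p ∧ Reads d w T p (· + 1) := by
  obtain ⟨hT, him⟩ := h
  rw [card_rect] at him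
  have hex : ∀ k < d * w, ∃ x, x ∈ rect d w ∧ T x = k + 1 := by
    intro k hk
    have : k + 1 ∈ (rect d w).image T := by rw [him, Finset.mem_Icc]; lia
    exact Finset.mem_image.mp this
  choose! p hp using hex
  have e : ∀ k < d * w, (if k < d * w then p k else 0) = p k := fun k hk => if_pos hk
  refine ⟨fun k => if k < d * w then p k else 0, ⟨fun k hk => ?_, fun k hk l hl hkl => ?_,
    fun k hk => if_neg (by lia)⟩, fun k hk => ?_, hT.zero_of_notMem⟩
  · rw [e k hk]; exact (hp k hk).1
  · rw [e k hk, e l hl] at hkl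
    have := hT.mono hkl (hp l hl).1
    rw [(hp k hk).2, (hp l hl).2] at this
    lia
  · rw [e k hk]; exact (hp k hk).2

theorem Reads.unique {d w : ℕ} {T : ℕ × ℕ → ℕ} {p q : ℕ → ℕ × ℕ} (hp : IsLinExt d w p)
    (hq : IsLinExt d w q) (h : Reads d w T p (· + 1)) (h' : Reads d w T q (· + 1)) : p = q := by
  ext1 k
  by_cases hk : k < d * w
  · obtain ⟨l, hl, e⟩ := hq.surj (hp.mem k hk)
    have h1 := h.apply_eq k hk
    rw [← e, h'.apply_eq l hl] at h1
    rw [← e, show l = k by simpa using h1]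
  · rw [hp.zero k (by lia), hq.zero k (by lia)]

theorem exists_reads {d w : ℕ} {p : ℕ → ℕ × ℕ} (hp : IsLinExt d w p) (v : ℕ → ℕ) :
    ∃ T, Reads d w T p v := by
  classical
  refine ⟨fun x => if h : ∃ k < d * w, p k = x then v h.choose else 0, fun k hk => ?_,
    fun x hx => ?_⟩
  · have h : ∃ l < d * w, p l = p k := ⟨k, hk, rfl⟩
    rw [dif_pos h]
    rw [hp.inj h.choose_spec.1 hk h.choose_spec.2]
  · rw [dif_neg]
    rintro ⟨k, hk, rfl⟩
    exact hx (hp.mem k hk)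

theorem Reads.rotate {d w : ℕ} {T : ℕ × ℕ → ℕ} {p : ℕ → ℕ × ℕ} (hp : IsLinExt d w p)
    (h : Reads d w T p (· + 1)) : Reads d w (rotate d w T) (rot d w p) (· + 1) := by
  refine ⟨fun k hk => ?_, fun x hx => if_neg hx⟩
  have hsup : (rect d w).sup T = d * w := by
    refine le_antisymm (Finset.sup_le fun x hx => ?_) ?_
    · obtain ⟨k, hk, rfl⟩ := hp.surj hx
      rw [h.apply_eq k hk]
      lia
    · have := Finset.le_sup (f := T) (hp.mem (d * w - 1) (by lia))
      rw [h.apply_eq _ (by lia)] at this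
      lia
  unfold RectTableau.rotate
  rw [if_pos (hp.rot.mem k hk), hsup]
  have hr := congrFun hp.rot_rot (d * w - 1 - k)
  rw [rot_apply (by lia), show d * w - 1 - (d * w - 1 - k) = k by lia] at hr
  rw [hr, h.apply_eq _ (by lia)]
  lia

theorem mem_rotInvSYT_iff {d w : ℕ} {T : ℕ × ℕ → ℕ} {p : ℕ → ℕ × ℕ} (hp : IsLinExt d w p)
    (h : Reads d w T p (· + 1)) : T ∈ rotInvSYT d w ↔ evac (d * w) p = p := by
  rw [hp.evac_eq_rot]
  have hr := h.rotate hp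
  refine ⟨fun hT => ?_, fun e => ⟨h.mem_SYT hp, ?_⟩⟩
  · rw [hT.2] at hr
    exact hr.unique hp.rot hp h
  · rw [e] at hr
    exact hr.eq hp h

theorem finite_rotInvSYT (d w : ℕ) : (rotInvSYT d w).Finite := by
  refine Set.Finite.of_injOn (f := fun T (x : rect d w) => T x)
    (t := {f | ∀ x, f x ∈ Set.Iic (d * w)}) ?_ ?_ (Set.Finite.pi' fun _ => Set.finite_Iic _)
  · intro T hT x
    have := Finset.mem_image_of_mem T x.2
    rw [hT.1.2, card_rect, Finset.mem_Icc] at this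
    exact this.2
  · intro T hT T' hT' h
    ext1 x
    by_cases hx : x ∈ rect d w
    · exact congrFun h ⟨x, hx⟩
    · rw [hT.1.1.zero_of_notMem x hx, hT'.1.1.zero_of_notMem x hx]

theorem IsLinExt.toggle_eq_self_iff {d w : ℕ} {p : ℕ → ℕ × ℕ} (hp : IsLinExt d w p) {i : ℕ}
    (hi : i + 1 < d * w) : RectTableau.toggle i p = p ↔ p i ≤ p (i + 1) := by
  rw [← hp.near_succ_iff hi]
  refine ⟨fun h => ?_, toggle_of_near⟩
  by_contra hn
  rw [toggle_of_not_near hn] at h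
  have h1 := congrFun h i
  rw [Function.comp_apply, Equiv.swap_apply_left] at h1
  have := hp.inj hi (by lia) h1
  lia

/-! ### Domino tableaux as linear extensions. -/

/-- The two boxes of a domino. -/
theorem IsRibbon.exists_covBy {S : Finset (ℕ × ℕ)} (h : IsRibbon 2 S) :
    ∃ x y, x ⋖ y ∧ S = {x, y} := by
  obtain ⟨x, y, hxy, rfl⟩ := Finset.card_eq_two.mp h.card_eq
  obtain ⟨walk⟩ := h.connected.preconnected ⟨x, by simp⟩ ⟨y, by simp⟩
  have hadj : (SimpleGraph.hasse (ℕ × ℕ)).Adj x y := by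
    cases walk with
    | nil => exact absurd rfl hxy
    | @cons _ z _ hz _ =>
      obtain ⟨z, hzm⟩ := z
      have hz' : (SimpleGraph.hasse (ℕ × ℕ)).Adj x z := hz
      simp only [Finset.coe_insert, Finset.coe_singleton, Set.mem_insert_iff,
        Set.mem_singleton_iff] at hzm
      rcases hzm with rfl | rfl
      · exact absurd rfl hz'.ne
      · exact hz'
  rcases SimpleGraph.hasse_adj.mp hadj with h | h
  · exact ⟨x, y, h, rfl⟩
  · exact ⟨y, x, h, Finset.pair_comm x y⟩

/-- Each domino is listed with its blue box first. Across dominoes the entries of `D` force the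
order, and within one the covering relation does. -/
theorem exists_reads_of_mem_dominoTableaux {d w M : ℕ} (hM : d * w = 2 * M) {D : ℕ × ℕ → ℕ}
    (h : D ∈ dominoTableaux (rect d w)) :
    ∃ p, IsLinExt d w p ∧ Reads d w D p (fun k => k / 2 + 1) ∧
      ∀ k < M, p (2 * k) ≤ p (2 * k + 1) := by
  obtain ⟨hD, l, hl, -, hrib⟩ := h
  rw [card_rect] at hl
  obtain rfl : l = M := by lia
  have hex : ∀ k < l, ∃ x y, x ⋖ y ∧ (rect d w).filter (fun z => D z = k + 1) = {x, y} :=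
    fun k hk => (hrib (k + 1) (Finset.mem_Icc.mpr (by lia))).exists_covBy
  choose! x y hxy hf using hex
  have hx : ∀ k < l, x k ∈ rect d w ∧ D (x k) = k + 1 := fun k hk => by
    rw [← Finset.mem_filter (p := fun z => D z = k + 1), hf k hk]; simp
  have hy : ∀ k < l, y k ∈ rect d w ∧ D (y k) = k + 1 := fun k hk => by
    rw [← Finset.mem_filter (p := fun z => D z = k + 1), hf k hk]; simp
  let p : ℕ → ℕ × ℕ := fun k =>
    if k < d * w then if k % 2 = 0 then x (k / 2) else y (k / 2) else 0
  have hp0 : ∀ k < d * w, k % 2 = 0 → p k = x (k / 2) := fun k h1 h2 => by simp [p, h1, h2]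
  have hp1 : ∀ k < d * w, k % 2 = 1 → p k = y (k / 2) := fun k h1 h2 => by simp [p, h1, h2]
  have hp : ∀ k < d * w, p k ∈ rect d w ∧ D (p k) = k / 2 + 1 := by
    intro k hk
    rcases Nat.mod_two_eq_zero_or_one k with h | h
    · rw [hp0 k hk h]; exact hx _ (by lia)
    · rw [hp1 k hk h]; exact hy _ (by lia)
  refine ⟨p, ⟨fun k hk => (hp k hk).1, fun k hk m hm hkm => ?_, fun k hk => if_neg (by lia)⟩,
    ⟨fun k hk => (hp k hk).2, hD.zero_of_notMem⟩, fun k hk => ?_⟩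
  · have h1 := hD.mono hkm (hp m hm).1
    rw [(hp k hk).2, (hp m hm).2] at h1
    by_contra hc
    have h2 : m / 2 = k / 2 := by lia
    rw [hp1 k hk (by lia), hp0 m hm (by lia), h2] at hkm
    exact absurd (hxy (k / 2) (by lia)).lt hkm.not_gt
  · rw [hp0 _ (by lia) (by lia), hp1 _ (by lia) (by lia),
      show 2 * k / 2 = k by lia, show (2 * k + 1) / 2 = k by lia]
    exact (hxy k hk).le

/-- The Young diagram of the first `s` boxes of a linear extension. -/
def prefixDiagram {d w : ℕ} {p : ℕ → ℕ × ℕ} (hp : IsLinExt d w p) (s : ℕ) (hs : s ≤ d * w) :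
    YoungDiagram where
  cells := (Finset.range s).image p
  isLowerSet := by
    intro x y hyx hx
    simp only [Finset.coe_image, Finset.coe_range, Set.mem_image, Set.mem_Iio] at hx ⊢
    obtain ⟨k, hk, rfl⟩ := hx
    obtain ⟨l, hl, rfl⟩ := hp.exists_of_le (by lia) hyx
    exact ⟨l, by lia, rfl⟩

/-- The prefixes of a linear extension are Young diagrams, and the pair is the difference of two of
them; comparability makes the boxes adjacent. -/
theorem isRibbon_pair {d w : ℕ} {p : ℕ → ℕ × ℕ} (hp : IsLinExt d w p) {k : ℕ}
    (hk : k + 1 < d * w) (h : p k ≤ p (k + 1)) : IsRibbon 2 {p k, p (k + 1)} := by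
  have hne : p k ≠ p (k + 1) := fun e => by have := hp.inj (by lia) hk e; lia
  refine ⟨⟨prefixDiagram hp (k + 2) (by lia), prefixDiagram hp k (by lia), ?_, ?_⟩, ?_,
    Finset.card_pair hne, ?_⟩
  · exact Finset.image_subset_image (Finset.range_subset_range.mpr (by lia))
  · ext z
    simp only [prefixDiagram, Finset.mem_insert, Finset.mem_singleton, Finset.mem_sdiff,
      Finset.mem_image, Finset.mem_range]
    constructor
    · rintro (rfl | rfl)
      · exact ⟨⟨k, by lia, rfl⟩, fun ⟨l, hl, e⟩ => by
          have := hp.inj (by lia) (by lia) e; lia⟩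
      · exact ⟨⟨k + 1, by lia, rfl⟩, fun ⟨l, hl, e⟩ => by
          have := hp.inj (by lia) (by lia) e; lia⟩
    · rintro ⟨⟨l, hl, rfl⟩, h2⟩
      have : ¬ l < k := fun hlk => h2 ⟨l, hlk, rfl⟩
      rcases (show l = k ∨ l = k + 1 by lia) with rfl | rfl
      · exact Or.inl rfl
      · exact Or.inr rfl
  · rw [Finset.coe_pair]
    refine SimpleGraph.induce_pair_connected_of_adj (SimpleGraph.hasse_adj.mpr (Or.inl ?_))
    rw [Prod.covBy_iff]
    rcases hp.eq_of_le_succ hk h with e | e <;> rw [e]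
    · exact Or.inr ⟨Order.covBy_add_one _, rfl⟩
    · exact Or.inl ⟨Order.covBy_add_one _, rfl⟩
  · rintro i j ⟨h1, h2, h3, -⟩
    simp only [Finset.mem_insert, Finset.mem_singleton] at h1 h2 h3
    have n1 : ((i, j) : ℕ × ℕ) ≠ (i, j + 1) := by simp
    have n2 : ((i, j) : ℕ × ℕ) ≠ (i + 1, j) := by simp
    have n3 : ((i, j + 1) : ℕ × ℕ) ≠ (i + 1, j) := by simp
    rcases h1 with h1 | h1 <;> rcases h2 with h2 | h2 <;> rcases h3 with h3 | h3
    all_goals first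
      | exact n1 (h1.trans h2.symm)
      | exact n2 (h1.trans h3.symm)
      | exact n3 (h2.trans h3.symm)

theorem Reads.filter_eq {d w : ℕ} {D : ℕ × ℕ → ℕ} {p : ℕ → ℕ × ℕ} (hp : IsLinExt d w p)
    (h : Reads d w D p (fun k => k / 2 + 1)) {k : ℕ} (hk : 2 * k + 1 < d * w) :
    (rect d w).filter (fun x => D x = k + 1) = {p (2 * k), p (2 * k + 1)} := by
  ext x
  simp only [Finset.mem_filter, Finset.mem_insert, Finset.mem_singleton]
  constructor
  · rintro ⟨hx, e⟩
    obtain ⟨l, hl, rfl⟩ := hp.surj hx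
    rw [h.apply_eq l hl] at e
    rcases (show l = 2 * k ∨ l = 2 * k + 1 by lia) with rfl | rfl
    · exact Or.inl rfl
    · exact Or.inr rfl
  · rintro (rfl | rfl)
    · exact ⟨hp.mem _ (by lia), by rw [h.apply_eq _ (by lia)]; lia⟩
    · exact ⟨hp.mem _ (by lia), by rw [h.apply_eq _ (by lia)]; lia⟩

theorem Reads.mem_dominoTableaux {d w M : ℕ} (hM : d * w = 2 * M) {D : ℕ × ℕ → ℕ}
    {p : ℕ → ℕ × ℕ} (hp : IsLinExt d w p) (h : Reads d w D p (fun k => k / 2 + 1))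
    (hd : ∀ k < M, p (2 * k) ≤ p (2 * k + 1)) : D ∈ dominoTableaux (rect d w) := by
  refine ⟨h.isTableau hp (fun a b hab => Nat.succ_le_succ (Nat.div_le_div_right hab))
    fun k => Nat.succ_pos _, M, by rw [card_rect, hM], ?_, fun i hi => ?_⟩
  · ext n
    rw [Finset.mem_image, Finset.mem_Icc]
    constructor
    · rintro ⟨x, hx, rfl⟩
      obtain ⟨k, hk, rfl⟩ := hp.surj hx
      rw [h.apply_eq k hk]
      lia
    · intro hn
      refine ⟨p (2 * (n - 1)), hp.mem _ (by lia), ?_⟩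
      rw [h.apply_eq _ (by lia)]
      lia
  · obtain ⟨h1, h2⟩ := Finset.mem_Icc.mp hi
    obtain ⟨k, rfl⟩ : ∃ k, i = k + 1 := ⟨i - 1, by lia⟩
    rw [h.filter_eq hp (by lia)]
    exact isRibbon_pair hp (by lia) (hd k (by lia))

theorem Reads.redBox_eq {d w : ℕ} {D : ℕ × ℕ → ℕ} {p : ℕ → ℕ × ℕ} (hp : IsLinExt d w p)
    (h : Reads d w D p (fun k => k / 2 + 1)) {k : ℕ} (hk : 2 * k + 1 < d * w)
    (hle : p (2 * k) ≤ p (2 * k + 1)) : redBox d w D (k + 1) = p (2 * k + 1) := by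
  unfold redBox
  rw [h.filter_eq hp hk, Finset.sup_insert, Finset.sup_singleton]
  exact sup_eq_right.mpr hle

theorem Reads.redSlides {d w M : ℕ} (hM : d * w = 2 * M) {D : ℕ × ℕ → ℕ} {p : ℕ → ℕ × ℕ}
    (hp : IsLinExt d w p) (h : Reads d w D p (fun k => k / 2 + 1))
    (hd : ∀ k < M, p (2 * k) ≤ p (2 * k + 1)) :
    Reads d w (redSlides d w D) (unshuffle M M p) (· + 1) := by
  unfold RectTableau.redSlides
  rw [show d * w / 2 = M by lia]
  refine Reads.redSlidesFrom hM hp (h.congr fun k hk => ?_) le_rfl fun j hj =>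
    h.redBox_eq hp (by lia) (hd j hj)
  unfold stageEntry
  rw [if_pos (by lia)]

theorem Reads.phi {d w M : ℕ} (hM : d * w = 2 * M) {D : ℕ × ℕ → ℕ} {p : ℕ → ℕ × ℕ}
    (hp : IsLinExt d w p) (h : Reads d w D p (fun k => k / 2 + 1))
    (hd : ∀ k < M, p (2 * k) ≤ p (2 * k + 1)) :
    Reads d w (phi d w D) ((evac M * unshuffle M M) p) (· + 1) := by
  unfold RectTableau.phi
  rw [show d * w / 2 = M by lia]
  exact (h.redSlides hM hp hd).evacuation (hp.unshuffle (by lia) le_rfl) (by lia)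

/-! ### The bijection. -/

theorem IsLinExt.evac_inv {d w n : ℕ} {p : ℕ → ℕ × ℕ} (hp : IsLinExt d w p) (h : n ≤ d * w) :
    IsLinExt d w ((RectTableau.evac n)⁻¹ p) := by
  induction n with
  | zero => exact hp
  | succ n ih =>
    rw [RectTableau.evac, mul_inv_rev]
    exact (ih (by lia)).pass_inv (by lia)

theorem IsLinExt.unshuffle_inv {d w M k : ℕ} {p : ℕ → ℕ × ℕ} (hp : IsLinExt d w p)
    (h : 2 * M ≤ d * w) (hk : k ≤ M) : IsLinExt d w ((RectTableau.unshuffle M k)⁻¹ p) := by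
  induction k with
  | zero => exact hp
  | succ k ih =>
    rw [RectTableau.unshuffle, mul_inv_rev]
    exact (ih (by lia)).pass_inv (by lia)

/-- Under `evac M * unshuffle M M`, the linear extensions made of dominoes correspond to those
fixed by evacuation. -/
theorem IsLinExt.evac_fixed_iff {d w M : ℕ} (hM : d * w = 2 * M) {p : ℕ → ℕ × ℕ}
    (hp : IsLinExt d w p) :
    RectTableau.evac (d * w) ((RectTableau.evac M * RectTableau.unshuffle M M) p) =
        (RectTableau.evac M * RectTableau.unshuffle M M) p ↔
      ∀ k < M, p (2 * k) ≤ p (2 * k + 1) := by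
  rw [← Equiv.Perm.mul_apply (RectTableau.evac (d * w)), hM, evac_mul_unshuffle,
    Equiv.Perm.mul_apply, EmbeddingLike.apply_eq_iff_eq, dominoToggle_eq_self_iff]
  exact forall₂_congr fun k hk => hp.toggle_eq_self_iff (by lia)

/-- On readings, `phi` is a permutation that preserves linear extensions in both directions, which
gives injectivity and preimages; `IsLinExt.evac_fixed_iff` matches the domino condition with
invariance. -/
theorem bijOn_phi {d w M : ℕ} (hM : d * w = 2 * M) :
    Set.BijOn (phi d w) (dominoTableaux (rect d w)) (rotInvSYT d w) := by
  have lin : ∀ {p}, IsLinExt d w p → IsLinExt d w ((evac M * unshuffle M M) p) := fun hp =>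
    (hp.unshuffle (by lia) le_rfl).evac (by lia)
  refine ⟨fun D hD => ?_, fun D hD D' hD' e => ?_, fun T hT => ?_⟩
  · obtain ⟨p, hp, h, hd⟩ := exists_reads_of_mem_dominoTableaux hM hD
    exact (mem_rotInvSYT_iff (lin hp) (h.phi hM hp hd)).mpr ((hp.evac_fixed_iff hM).mpr hd)
  · obtain ⟨p, hp, h, hd⟩ := exists_reads_of_mem_dominoTableaux hM hD
    obtain ⟨p', hp', h', hd'⟩ := exists_reads_of_mem_dominoTableaux hM hD'
    have h1 := h.phi hM hp hd
    rw [e] at h1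
    have h2 := h1.unique (lin hp) (lin hp') (h'.phi hM hp' hd')
    rw [EmbeddingLike.apply_eq_iff_eq] at h2
    rw [← h2] at h'
    exact h.eq hp h'
  · obtain ⟨q, hq, h⟩ := exists_reads_of_mem_SYT hT.1
    obtain ⟨p, hp, rfl⟩ : ∃ p, IsLinExt d w p ∧ (evac M * unshuffle M M) p = q :=
      ⟨(unshuffle M M)⁻¹ ((evac M)⁻¹ q), (hq.evac_inv (by lia)).unshuffle_inv (by lia) le_rfl,
        by simp⟩
    have hd := (hp.evac_fixed_iff hM).mp ((mem_rotInvSYT_iff hq h).mp hT)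
    obtain ⟨D, hD⟩ := exists_reads hp (fun k => k / 2 + 1)
    exact ⟨D, hD.mem_dominoTableaux hM hp hd, (hD.phi hM hp hd).eq hq h⟩

end RectTableau

theorem corollary3p8 (d w : ℕ) (hN : Even (d * w)) :
    (RectTableau.rotInvSYT d w).Finite ∧
    (RectTableau.dominoTableaux (RectTableau.rect d w)).Finite ∧
    (RectTableau.rotInvSYT d w).ncard =
      (RectTableau.dominoTableaux (RectTableau.rect d w)).ncard ∧
    Set.MapsTo (RectTableau.redSlides d w)
      (RectTableau.dominoTableaux (RectTableau.rect d w))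
      (RectTableau.SYT (RectTableau.rect d w)) ∧
    Set.BijOn (RectTableau.phi d w)
      (RectTableau.dominoTableaux (RectTableau.rect d w))
      (RectTableau.rotInvSYT d w) := by
  obtain ⟨M, hM⟩ := hN.exists_two_nsmul
  rw [smul_eq_mul] at hM
  have hb := RectTableau.bijOn_phi hM
  have hfin := RectTableau.finite_rotInvSYT d w
  refine ⟨hfin, hb.finite_iff_finite.mpr hfin, hb.ncard_eq.symm, fun D hD => ?_, hb⟩
  obtain ⟨p, hp, h, hd⟩ := RectTableau.exists_reads_of_mem_dominoTableaux hM hD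
  exact (h.redSlides hM hp hd).mem_SYT (hp.unshuffle (by lia) le_rfl)
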